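/- Let $d\ge 1$ and let $f:[0,\infty)\to\mathbb R\cup\{+\infty\}$ be convex and lower semicontinuous with $f(1)=0$ and $\lim_{t\to\infty} f(t)/t>0$. For probability measures $\mu,\nu$ on a measurable space put $D_{f,\nu}(\mu)=\int f\!\left(\frac{d\mu}{d\nu}\right)d\nu$ if $\mu\ll\nu$, and $D_{f,\nu}(\mu)=+\infty$ otherwise. For probability measures $\mu,\nu$ on $\mathbb R$ and an integer $K\ge 0$, let $Q^{(K)}_{\mu\mid\nu}(n)=\mathbb P\big(\#\{j\in\{1,\dots,K\}:\tilde Y_j\le Y\}=n\big)$, $0\le n\le K$, where $Y\sim\mu$ and $\tilde Y_1,\dots,\tilde Y_K\sim\nu$ are independent, and let $$D^{(K)}_{f,\nu}(\mu)=\frac1{K+1}\sum_{n=0}^{K} f\big((K+1)\,Q^{(K)}_{\mu\mid\nu}(n)\big).$$ If $\mu\ll\nu$, let $r_{\mu\mid\nu}=\frac{d\mu}{d\nu}\circ Q_\nu$, where $Q_\nu(u)=\inf\{x\in\mathbb R: u\le\nu((-\infty,x])\}$ is the quantile function of $\nu$; this function is determined Lebesgue-almost everywhere on $(0,1)$, and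 $r_{\mu\mid\nu}\in C([0,1])$ means that it agrees almost everywhere with a continuous function on $[0,1]$. For a probability measure $\mu$ on $\mathbb R^d$ and $s\in\mathbb S^{d-1}$, let $\mu_s$ be the pushforward of $\mu$ under $x\mapsto s^\top x$, let $\sigma$ be the uniform probability measure on $\mathbb S^{d-1}$, and for probability measures $\mu,\nu$ on $\mathbb R^d$ define $$\mathrm{S}D^{(K)}_{f,\nu}(\mu)=\int_{\mathbb S^{d-1}}D^{(K)}_{f,\nu_s}(\mu_s)\,d\sigma(s),\qquad \mathrm{SD}_{f,\nu}(\mu)=\int_{\mathbb S^{d-1}}D_{f,\nu_s}(\mu_s)\,d\sigma(s).$$ All these quantities may take the value $+\infty$. Then the following hold. 1. For every probability measure $\nu$ on $\mathbb R^d$ and every $K\ge 0$, the map $\mu\mapsto \mathrm{S}D^{(K)}_{f,\nu}(\mu)$ is convex on the set of probability measures on $\mathbb R^d$. 2. Let $\mu\ll\nu$ be probability measures on $\mathbb R^d$. Then $\mathrm{SD}_{f,\nu}(\mu)\le D_{f,\nu}(\mu)$. If moreover $\nu$ has no atoms, that is, $\nu(\{x\})=0$ for all $x\in\mathbb R^d$,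 then $\mathrm{S}D^{(K)}_{f,\nu}(\mu)\le\mathrm{SD}_{f,\nu}(\mu)$ for every $K\ge 0$. 3. Let $\mu\ll\nu$ be probability measures on $\mathbb R^d$ and let $\nu$ have no atoms. If $r_{\mu_s\mid\nu_s}\in C([0,1])$ for $\sigma$-almost every $s\in\mathbb S^{d-1}$, then $\lim_{K\to\infty}\mathrm{S}D^{(K)}_{f,\nu}(\mu)=\mathrm{SD}_{f,\nu}(\mu)$ in $[0,+\infty]$. -/

import Mathlib

open MeasureTheory Filter Topology Set
open scoped NNReal ENNReal

noncomputable section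

/-- Entropy functions `f : [0, ∞) → ℝ ∪ {+∞}`: convex, lower semicontinuous, with `f 1 = 0` and
`lim_{t → ∞} f t / t > 0` (the limit may be `+∞`). In `EReal` one has `0 * ⊤ = 0`. -/
structure IsEntropyFunction (f : ℝ≥0 → EReal) : Prop where
  ne_bot : ∀ t, f t ≠ ⊥
  convex : ∀ x y a b : ℝ≥0, a + b = 1 →
    f (a * x + b * y) ≤ ((a : ℝ) : EReal) * f x + ((b : ℝ) : EReal) * f y
  lsc : LowerSemicontinuous f
  map_one : f 1 = 0
  recession_pos : ∃ l : EReal, 0 < l ∧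
    Tendsto (fun t : ℝ≥0 => f t / ((t : ℝ) : EReal)) atTop (𝓝 l)

/-- The integral of an extended-real valued function, as the integral of its positive part minus
the integral of its negative part. -/
def eintegral {Ω : Type*} [MeasurableSpace Ω] (ρ : Measure Ω) (g : Ω → EReal) : EReal :=
  ((∫⁻ x, (g x).toENNReal ∂ρ : ℝ≥0∞) : EReal) - ((∫⁻ x, (-g x).toENNReal ∂ρ : ℝ≥0∞) : EReal)

open Classical in
/-- The `f`-divergence `D_{f,ν}(μ) = ∫ f (dμ/dν) dν` if `μ ≪ ν`, and `+∞` otherwise. -/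
def fDivergence {Ω : Type*} [MeasurableSpace Ω] (f : ℝ≥0 → EReal) (ν μ : Measure Ω) : EReal :=
  if μ ≪ ν then eintegral ν (fun x => f (μ.rnDeriv ν x).toNNReal) else ⊤

/-- The number of indices `j` with `z j ≤ y`. -/
def rankStatistic {K : ℕ} (y : ℝ) (z : Fin K → ℝ) : ℕ :=
  (Finset.univ.filter fun j => z j ≤ y).card

/-- The probability mass function of the rank statistic of order `K` of `μ` with respect to `ν`:
the probability that `rankStatistic Y Z = n`, where `Y ∼ μ`, `Z 0, …, Z (K - 1) ∼ ν`, all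
independent. -/
def rankPmf (μ ν : Measure ℝ) (K n : ℕ) : ℝ≥0 :=
  ((μ.prod (Measure.pi fun _ : Fin K => ν)) {p | rankStatistic p.1 p.2 = n}).toNNReal

/-- The univariate rank-statistic `f`-divergence of order `K`,
`(K + 1)⁻¹ * ∑_{n = 0}^{K} f ((K + 1) * Q n)` with `Q` the pmf of the rank statistic. -/
def rankDivergence (f : ℝ≥0 → EReal) (K : ℕ) (ν μ : Measure ℝ) : EReal :=
  ((((K : ℝ) + 1)⁻¹ : ℝ) : EReal) *
    ∑ n ∈ Finset.range (K + 1), f (((K : ℝ≥0) + 1) * rankPmf μ ν K n)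

/-- The quantile function of a probability measure on `ℝ` (used for `u ∈ (0, 1)`). -/
def quantile (ν : Measure ℝ) (u : ℝ) : ℝ :=
  sInf {x : ℝ | u ≤ ProbabilityTheory.cdf ν x}

/-- The quantile ratio `r_{μ|ν} = (dμ/dν) ∘ Q_ν`. -/
def quantileRatio (μ ν : Measure ℝ) (u : ℝ) : ℝ :=
  (μ.rnDeriv ν (quantile ν u)).toReal

/-- `r_{μ|ν} ∈ C([0, 1])`. As `dμ/dν` is determined only `ν`-almost everywhere, `r_{μ|ν}` is
determined only Lebesgue-almost everywhere on `(0, 1)`, and the condition says that it agrees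
almost everywhere with a continuous function on `[0, 1]`. -/
def HasContinuousQuantileRatio (μ ν : Measure ℝ) : Prop :=
  ∃ r : ℝ → ℝ, ContinuousOn r (Icc 0 1) ∧
    ∀ᵐ u ∂(volume.restrict (Ioo (0 : ℝ) 1)), quantileRatio μ ν u = r u

/-- The unit sphere `S^{d-1}` in `ℝ^d`. -/
abbrev UnitSphere (d : ℕ) : Type := Metric.sphere (0 : EuclideanSpace ℝ (Fin d)) 1

/-- The uniform probability measure on `S^{d-1}` (for `d ≥ 1`): the normalized surface measure. -/
def sphereUniform (d : ℕ) : Measure (UnitSphere d) :=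
  ((volume : Measure (EuclideanSpace ℝ (Fin d))).toSphere univ)⁻¹ •
    (volume : Measure (EuclideanSpace ℝ (Fin d))).toSphere

/-- The projection `μ_s` of `μ`: its pushforward under `x ↦ ⟨s, x⟩`. -/
def projMeasure {d : ℕ} (μ : Measure (EuclideanSpace ℝ (Fin d))) (s : UnitSphere d) : Measure ℝ :=
  μ.map fun x => inner ℝ (s : EuclideanSpace ℝ (Fin d)) x

/-- The sliced rank-statistic `f`-divergence of order `K`. -/
def slicedRankDivergence {d : ℕ} (f : ℝ≥0 → EReal) (K : ℕ)
    (ν μ : Measure (EuclideanSpace ℝ (Fin d))) : EReal :=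
  eintegral (sphereUniform d) fun s => rankDivergence f K (projMeasure ν s) (projMeasure μ s)

/-- The sliced `f`-divergence `SD_{f,ν}(μ)`. -/
def slicedFDivergence {d : ℕ} (f : ℝ≥0 → EReal)
    (ν μ : Measure (EuclideanSpace ℝ (Fin d))) : EReal :=
  eintegral (sphereUniform d) fun s => fDivergence f (projMeasure ν s) (projMeasure μ s)

end

noncomputable section

/-! By Hahn–Banach an entropy function is a t + b plus a supremum of positive parts of countably
many affine functions. Against a density of mean one the affine part contributes the constant a + b,
which f 1 = 0 identifies with -`affineSup α β 1`. Hence each divergence is a [0, ∞]-valued integral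
or average of `affineSup` minus one finite constant, and all comparisons take place in [0, ∞].

Given Y = y, the rank is binomial with success probability `cdf ν y`, so the rank pmf integrates
Bernstein weights against μ. It is linear in μ, whence convexity. If ν has no atoms, `cdf ν` is
uniform under ν and (K + 1) Q n is the mean of dμ/dν under a probability with a beta weight as
density; Jensen and the partition of unity give `affineSupRankDivergence_le`. Data processing
(`lintegral_affineSup_rnDeriv_map_le`) bounds each projected divergence by the one on ℝ^d.

For the limit, the beta weight with n = ⌊(K + 1) u⌋ concentrates at u, so (K + 1) Q n tends to r u
for continuous r. Lower semicontinuity and Fatou give the lower bound on each slice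
(`affineSupDivergence_le_liminf`), and Fatou on the sphere combines the slices. Almost every
projection of an atomless ν is atomless (`ae_projMeasure_singleton_eq_zero`). -/

/-! ### Affine minorants of an entropy function. -/

lemma IsEntropyFunction.convex_epigraph {f : ℝ≥0 → EReal} (hf : IsEntropyFunction f) :
    Convex ℝ {p : ℝ × ℝ | 0 ≤ p.1 ∧ f p.1.toNNReal ≤ ((p.2 : ℝ) : EReal)} := by
  rintro ⟨x, y⟩ ⟨hx, hy⟩ ⟨x', y'⟩ ⟨hx', hy'⟩ a b ha hb hab
  simp only at hx hy hx' hy'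
  lift x to ℝ≥0 using hx
  lift x' to ℝ≥0 using hx'
  lift a to ℝ≥0 using ha
  lift b to ℝ≥0 using hb
  refine ⟨by simp only [Prod.smul_mk, Prod.mk_add_mk, smul_eq_mul]; positivity, ?_⟩
  have h := hf.convex x x' a b (by exact_mod_cast hab)
  simp only [Real.toNNReal_coe] at hy hy'
  have e : ((a : ℝ) • ((x : ℝ), y) + (b : ℝ) • ((x' : ℝ), y')).1.toNNReal = a * x + b * x' := by
    simp only [Prod.smul_mk, Prod.mk_add_mk, smul_eq_mul]
    exact_mod_cast Real.toNNReal_coe (r := a * x + b * x')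
  rw [e]
  refine h.trans ?_
  simp only [Prod.smul_mk, Prod.mk_add_mk, smul_eq_mul, EReal.coe_add, EReal.coe_mul]
  gcongr

lemma IsEntropyFunction.isClosed_epigraph {f : ℝ≥0 → EReal} (hf : IsEntropyFunction f) :
    IsClosed {p : ℝ × ℝ | 0 ≤ p.1 ∧ f p.1.toNNReal ≤ ((p.2 : ℝ) : EReal)} := by
  have h := lowerSemicontinuous_iff_isClosed_epigraph.1 hf.lsc
  have hc : Continuous fun p : ℝ × ℝ => (p.1.toNNReal, ((p.2 : ℝ) : EReal)) := by
    refine Continuous.prodMk ?_ ?_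
    · exact continuous_real_toNNReal.comp continuous_fst
    · exact continuous_coe_real_ereal.comp continuous_snd
  exact (isClosed_le continuous_const continuous_fst).inter (h.preimage hc)

/-- A hyperplane that separates a point below the graph from the epigraph. -/
lemma IsEntropyFunction.exists_separation {f : ℝ≥0 → EReal} (hf : IsEntropyFunction f)
    (t₀ : ℝ≥0) (c : ℝ) (hc : (c : EReal) < f t₀) :
    ∃ A B u : ℝ, 0 ≤ B ∧ A * t₀ + B * c < u ∧
      ∀ (t : ℝ≥0) (y : ℝ), f t ≤ (y : EReal) → u < A * t + B * y := by
  obtain ⟨L, u, h₁, h₂⟩ := geometric_hahn_banach_point_closed hf.convex_epigraph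
    hf.isClosed_epigraph (x := ((t₀ : ℝ), c)) (by simpa using hc)
  have hL : ∀ x y : ℝ, L (x, y) = L (1, 0) * x + L (0, 1) * y := by
    intro x y
    have : ((x, y) : ℝ × ℝ) = x • (1, 0) + y • (0, 1) := by simp
    rw [this, map_add, map_smul, map_smul]
    simp [mul_comm]
  have key : ∀ (t : ℝ≥0) (y : ℝ), f t ≤ (y : EReal) → u < L (1, 0) * t + L (0, 1) * y := by
    intro t y hy
    rw [← hL]
    exact h₂ _ ⟨t.2, by simpa using hy⟩
  refine ⟨L (1, 0), L (0, 1), u, ?_, by rw [← hL]; exact h₁, key⟩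
  by_contra! hB
  set B := L (0, 1)
  set A := L (1, 0)
  -- The epigraph contains the ray of nonnegative heights over 1; with B < 0 the functional would
  -- drop to at most u at this height.
  have h := key 1 (max 0 ((u - A) / B)) (by rw [hf.map_one]; exact_mod_cast le_max_left _ _)
  have h' : B * max 0 ((u - A) / B) ≤ B * ((u - A) / B) :=
    mul_le_mul_of_nonpos_left (le_max_right _ _) hB.le
  rw [mul_div_cancel₀ _ hB.ne] at h'
  simp only [NNReal.coe_one, mul_one] at h
  linarith

lemma EReal.coe_le_of_forall_le {x : ℝ} {z : EReal} (hz : z ≠ ⊥)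
    (h : ∀ y : ℝ, z ≤ y → x ≤ y) : (x : EReal) ≤ z := by
  induction z with
  | bot => exact absurd rfl hz
  | top => exact le_top
  | coe r => exact_mod_cast h r le_rfl

/-- A non-vertical hyperplane is the graph of t ↦ (u - A t) / B. -/
lemma IsEntropyFunction.exists_affine_lt_of_pos {f : ℝ≥0 → EReal} (hf : IsEntropyFunction f)
    (t₀ : ℝ≥0) (c A B u : ℝ) (hB : 0 < B) (h₁ : A * t₀ + B * c < u)
    (h₂ : ∀ (t : ℝ≥0) (y : ℝ), f t ≤ (y : EReal) → u < A * t + B * y) :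
    ∃ p q : ℝ, (∀ t : ℝ≥0, ((p * t + q : ℝ) : EReal) ≤ f t) ∧ c < p * t₀ + q := by
  refine ⟨-A / B, u / B, fun t => EReal.coe_le_of_forall_le (hf.ne_bot t) fun y hy => ?_, ?_⟩
  · have e : -A / B * t + u / B = (u - A * t) / B := by ring
    rw [e, div_le_iff₀ hB]
    linarith [h₂ t y hy]
  · have e : -A / B * t₀ + u / B = (u - A * t₀) / B := by ring
    rw [e, lt_div_iff₀ hB]
    linarith

lemma IsEntropyFunction.exists_affine_le {f : ℝ≥0 → EReal} (hf : IsEntropyFunction f) :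
    ∃ p q : ℝ, ∀ t : ℝ≥0, ((p * t + q : ℝ) : EReal) ≤ f t := by
  obtain ⟨A, B, u, hB, h₁, h₂⟩ := hf.exists_separation 1 (-1)
    (by rw [hf.map_one]; exact_mod_cast neg_one_lt_zero)
  -- A vertical hyperplane cannot separate (1, -1) from (1, 0), which lies in the epigraph.
  have hB' : 0 < B := by
    refine lt_of_le_of_ne hB ?_
    rintro rfl
    have := h₂ 1 0 (by rw [hf.map_one]; simp)
    simp at this h₁
    linarith
  obtain ⟨p, q, h, -⟩ := hf.exists_affine_lt_of_pos 1 (-1) A B u hB' h₁ h₂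
  exact ⟨p, q, h⟩

/-- If the hyperplane is vertical, u - A t is negative wherever f is finite and positive at t₀.
Adding a large multiple of it to any affine minorant gives another minorant, which exceeds c at t₀.
-/
lemma IsEntropyFunction.exists_affine_lt {f : ℝ≥0 → EReal} (hf : IsEntropyFunction f)
    (t₀ : ℝ≥0) (c : ℝ) (hc : (c : EReal) < f t₀) :
    ∃ p q : ℝ, (∀ t : ℝ≥0, ((p * t + q : ℝ) : EReal) ≤ f t) ∧ c < p * t₀ + q := by
  obtain ⟨A, B, u, hB, h₁, h₂⟩ := hf.exists_separation t₀ c hc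
  rcases hB.lt_or_eq with hB' | rfl
  · exact hf.exists_affine_lt_of_pos t₀ c A B u hB' h₁ h₂
  obtain ⟨p, q, h⟩ := hf.exists_affine_le
  simp only [zero_mul, add_zero] at h₁ h₂
  obtain ⟨N, hN⟩ := exists_nat_gt ((c - (p * t₀ + q)) / (u - A * t₀))
  rw [div_lt_iff₀ (by linarith)] at hN
  refine ⟨p - N * A, q + N * u, fun t => EReal.coe_le_of_forall_le (hf.ne_bot t)
    fun y hy => ?_, by linarith⟩
  have h₃ : p * t + q ≤ y := by exact_mod_cast (h t).trans hy
  have h₄ : (N : ℝ) * (u - A * t) ≤ 0 :=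
    mul_nonpos_of_nonneg_of_nonpos (Nat.cast_nonneg N) (by linarith [h₂ t y hy])
  linarith

/-- Rational coefficients make the family of minorants countable. Lowering both coefficients by less
than δ preserves minorants because t ≥ 0, and costs less than δ (t₀ + 1), the available gap, at t₀.
-/
lemma IsEntropyFunction.exists_rat_affine_lt {f : ℝ≥0 → EReal} (hf : IsEntropyFunction f)
    (t₀ : ℝ≥0) (c : ℝ) (hc : (c : EReal) < f t₀) :
    ∃ p q : ℚ, (∀ t : ℝ≥0, ((p * t + q : ℝ) : EReal) ≤ f t) ∧ c < p * t₀ + q := by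
  obtain ⟨p, q, h, hpq⟩ := hf.exists_affine_lt t₀ c hc
  set δ := (p * t₀ + q - c) / (t₀ + 1) with hδ
  have ht : (0 : ℝ) < t₀ + 1 := by positivity
  have hδ' : δ * (t₀ + 1) = p * t₀ + q - c := by rw [hδ]; field_simp
  have hδ0 : 0 < δ := div_pos (by linarith) ht
  obtain ⟨p', hp₁, hp₂⟩ := exists_rat_btwn (show p - δ < p by linarith)
  obtain ⟨q', hq₁, hq₂⟩ := exists_rat_btwn (show q - δ < q by linarith)
  refine ⟨p', q', fun t => le_trans ?_ (h t), ?_⟩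
  · have : (p' : ℝ) * t ≤ p * t := mul_le_mul_of_nonneg_right hp₂.le t.2
    exact_mod_cast add_le_add this hq₂.le
  · have : (p - δ) * t₀ ≤ (p' : ℝ) * t₀ := mul_le_mul_of_nonneg_right hp₁.le t₀.2
    linarith

/-- The supremum of the positive parts of countably many affine functions. -/
def affineSup (α β : ℕ → ℝ) (t : ℝ≥0) : ℝ≥0∞ := ⨆ n, ENNReal.ofReal (α n * t + β n)

/-- An entropy function is the sum of an affine function and of a supremum of positive parts of
countably many affine functions. -/
theorem IsEntropyFunction.exists_eq_affineSup {f : ℝ≥0 → EReal} (hf : IsEntropyFunction f) :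
    ∃ (a b : ℝ) (α β : ℕ → ℝ), ∀ t : ℝ≥0,
      f t = ((a * t + b : ℝ) : EReal) + (affineSup α β t : EReal) := by
  obtain ⟨a, b, hab⟩ := hf.exists_affine_le
  set S : Set (ℚ × ℚ) := {z | ∀ t : ℝ≥0, ((z.1 * t + z.2 : ℝ) : EReal) ≤ f t} with hS
  have hne : S.Nonempty := by
    obtain ⟨p, q, h, -⟩ := hf.exists_rat_affine_lt 1 (-1)
      (by rw [hf.map_one]; exact_mod_cast neg_one_lt_zero)
    exact ⟨(p, q), h⟩
  obtain ⟨e, he⟩ := S.to_countable.exists_eq_range hne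
  -- The fixed minorant a t + b is subtracted from every rational one; since f stays above it,
  -- taking positive parts loses nothing.
  refine ⟨a, b, fun n => (e n).1 - a, fun n => (e n).2 - b, fun t => ?_⟩
  have hle : ∀ n, (((e n).1 * t + (e n).2 : ℝ) : EReal) ≤ f t := by
    intro n
    have : e n ∈ S := he ▸ mem_range_self n
    exact this t
  apply le_antisymm
  · by_contra! hlt
    have hM : affineSup (fun n => (e n).1 - a) (fun n => (e n).2 - b) t ≠ ⊤ := by
      intro h
      rw [h, EReal.coe_ennreal_top, EReal.coe_add_top] at hlt
      exact not_top_lt hlt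
    obtain ⟨m, hm⟩ := WithTop.ne_top_iff_exists.1 hM
    change (m : ℝ≥0∞) = _ at hm
    rw [← hm] at hlt
    obtain ⟨p, q, h₁, h₂⟩ := hf.exists_rat_affine_lt t (a * t + b + m) (by exact_mod_cast hlt)
    obtain ⟨n, hn⟩ : (p, q) ∈ range e := he ▸ h₁
    have h₃ := le_iSup (fun n => ENNReal.ofReal (((e n).1 - a) * t + ((e n).2 - b))) n
    change _ ≤ affineSup (fun n => (e n).1 - a) (fun n => (e n).2 - b) t at h₃
    rw [← hm, hn, ← ENNReal.ofReal_coe_nnreal, ENNReal.ofReal_le_ofReal_iff m.coe_nonneg] at h₃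
    simp only at h₃
    linarith
  · rcases eq_or_ne (f t) ⊤ with h | h
    · rw [h]; exact le_top
    lift f t to ℝ using ⟨h, hf.ne_bot t⟩ with x hx
    have h₁ : affineSup (fun n => (e n).1 - a) (fun n => (e n).2 - b) t
        ≤ ENNReal.ofReal (x - (a * t + b)) := by
      refine iSup_le fun n => ENNReal.ofReal_le_ofReal ?_
      have := hle n
      have : ((e n).1 * t + (e n).2 : ℝ) ≤ x := by exact_mod_cast this
      linarith
    have h₂ : a * t + b ≤ x := by
      have := hab t
      rw [← hx] at this
      exact_mod_cast this
    calc _ ≤ ((a * t + b : ℝ) : EReal) + (ENNReal.ofReal (x - (a * t + b)) : EReal) :=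
          add_le_add le_rfl (by exact_mod_cast h₁)
      _ = x := by
        rw [EReal.coe_ennreal_ofReal, max_eq_left (by linarith), ← EReal.coe_add]
        congr 1; ring

/-! ### Convexity and Jensen inequalities for `affineSup`. -/

lemma measurable_affineSup (α β : ℕ → ℝ) : Measurable (affineSup α β) := by
  unfold affineSup
  fun_prop

lemma lowerSemicontinuous_affineSup (α β : ℕ → ℝ) : LowerSemicontinuous (affineSup α β) := by
  unfold affineSup
  refine lowerSemicontinuous_iSup fun n => Continuous.lowerSemicontinuous ?_
  exact ENNReal.continuous_ofReal.comp (by fun_prop)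

lemma ofReal_le_affineSup (α β : ℕ → ℝ) (n : ℕ) (t : ℝ≥0) :
    ENNReal.ofReal (α n * t + β n) ≤ affineSup α β t :=
  le_iSup (fun n => ENNReal.ofReal (α n * t + β n)) n

lemma affineSup_convex (α β : ℕ → ℝ) (x y a b : ℝ≥0) (hab : a + b = 1) :
    affineSup α β (a * x + b * y) ≤ a * affineSup α β x + b * affineSup α β y := by
  refine iSup_le fun n => ?_
  have hab' : (a : ℝ) + b = 1 := by exact_mod_cast hab
  have e : α n * ((a * x + b * y : ℝ≥0) : ℝ) + β n
      = a * (α n * x + β n) + b * (α n * y + β n) := by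
    push_cast
    linear_combination (- β n) * hab'
  rw [e]
  refine ENNReal.ofReal_add_le.trans ?_
  rw [ENNReal.ofReal_mul a.coe_nonneg, ENNReal.ofReal_mul b.coe_nonneg,
    ENNReal.ofReal_coe_nnreal, ENNReal.ofReal_coe_nnreal]
  gcongr <;> exact ofReal_le_affineSup α β n _

lemma ofReal_integral_le_lintegral {Ω : Type*} [MeasurableSpace Ω] {ρ : Measure Ω} {g : Ω → ℝ}
    (hg : Integrable g ρ) : ENNReal.ofReal (∫ x, g x ∂ρ) ≤ ∫⁻ x, ENNReal.ofReal (g x) ∂ρ := by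
  rw [integral_eq_lintegral_pos_part_sub_lintegral_neg_part hg]
  refine (ENNReal.ofReal_le_ofReal (sub_le_self _ ENNReal.toReal_nonneg)).trans ?_
  exact ENNReal.ofReal_toReal_le

lemma integrable_coe_of_lintegral_eq {Ω : Type*} [MeasurableSpace Ω] {ρ : Measure Ω}
    {r : Ω → ℝ≥0} (hr : Measurable r) {m : ℝ≥0} (hm : ∫⁻ x, r x ∂ρ = m) :
    Integrable (fun x => (r x : ℝ)) ρ :=
  ⟨hr.coe_nnreal_real.aestronglyMeasurable, by
    simp [hasFiniteIntegral_iff_enorm, hm]⟩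

/-- Affine integrals depend only on total mass and mean. Finite measures are allowed so that it
applies to restrictions. -/
lemma integral_affine {Ω : Type*} [MeasurableSpace Ω] {ρ : Measure Ω} [IsFiniteMeasure ρ]
    {r : Ω → ℝ≥0} (hr : Measurable r) {m : ℝ≥0} (hm : ∫⁻ x, r x ∂ρ = m) (p q : ℝ) :
    Integrable (fun x => p * (r x : ℝ) + q) ρ ∧
      ∫ x, (p * (r x : ℝ) + q) ∂ρ = p * m + q * ρ.real univ := by
  have hi := integrable_coe_of_lintegral_eq hr hm
  refine ⟨(hi.const_mul p).add (integrable_const q), ?_⟩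
  rw [integral_add (hi.const_mul p) (integrable_const q), integral_const_mul, integral_const]
  have : ∫ x, (r x : ℝ) ∂ρ = m := by
    rw [integral_eq_lintegral_of_nonneg_ae (ae_of_all _ fun x => (r x).coe_nonneg)
      hr.coe_nnreal_real.aestronglyMeasurable]
    simp [hm]
  rw [this, smul_eq_mul, mul_comm q]

/-- Jensen's inequality for suprema of affine functions. -/
lemma affineSup_le_lintegral {Ω : Type*} [MeasurableSpace Ω] (α β : ℕ → ℝ) {P : Measure Ω}
    [IsProbabilityMeasure P] {r : Ω → ℝ≥0} (hr : Measurable r) {m : ℝ≥0}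
    (hm : ∫⁻ x, r x ∂P = m) : affineSup α β m ≤ ∫⁻ x, affineSup α β (r x) ∂P := by
  refine iSup_le fun n => ?_
  obtain ⟨hi, he⟩ := integral_affine hr hm (α n) (β n)
  rw [probReal_univ, mul_one] at he
  rw [← he]
  exact (ofReal_integral_le_lintegral hi).trans
    (lintegral_mono fun x => ofReal_le_affineSup α β n _)

lemma affineSup_le_average (α β : ℕ → ℝ) (N : ℕ) (q : ℕ → ℝ≥0)
    (hq : ∑ n ∈ Finset.range (N + 1), q n = N + 1) :
    affineSup α β 1 ≤ ((N : ℝ≥0∞) + 1)⁻¹ * ∑ n ∈ Finset.range (N + 1), affineSup α β (q n) := by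
  refine iSup_le fun i => ?_
  rw [mul_comm _⁻¹, ← div_eq_mul_inv, ENNReal.le_div_iff_mul_le (by simp) (by simp)]
  have h : ∀ s : Finset ℕ, ENNReal.ofReal (∑ n ∈ s, (α i * q n + β i))
      ≤ ∑ n ∈ s, affineSup α β (q n) := by
    intro s
    refine (Finset.le_sum_of_subadditive ENNReal.ofReal ENNReal.ofReal_zero.le
      (fun _ _ => ENNReal.ofReal_add_le) s _).trans ?_
    exact Finset.sum_le_sum fun n _ => ofReal_le_affineSup α β i _
  refine le_trans (le_of_eq ?_) (h _)
  have hq' : ∑ n ∈ Finset.range (N + 1), (q n : ℝ) = N + 1 := by exact_mod_cast hq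
  rw [Finset.sum_add_distrib, ← Finset.mul_sum, hq']
  have : ((N : ℝ≥0∞) + 1) = ENNReal.ofReal (N + 1) := by
    rw [ENNReal.ofReal_add (by positivity) (by positivity)]; simp
  rw [this, ← ENNReal.ofReal_mul' (by positivity)]
  congr 1
  simp
  ring

/-! ### Data processing inequality. -/

lemma withDensity_sup_le {Ω : Type*} [MeasurableSpace Ω] {ρ κ : Measure Ω} {g h : Ω → ℝ≥0∞}
    (hg : Measurable g) (hh : Measurable h) (hgκ : ρ.withDensity g ≤ κ)
    (hhκ : ρ.withDensity h ≤ κ) : ρ.withDensity (g ⊔ h) ≤ κ := by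
  refine Measure.le_iff.2 fun A hA => ?_
  have hB : MeasurableSet {x | g x ≤ h x} := measurableSet_le hg hh
  rw [withDensity_apply _ hA, ← lintegral_inter_add_sdiff _ A hB, ← measure_inter_add_sdiff A hB]
  refine add_le_add ?_ ?_
  · refine le_trans (le_of_eq ?_) (hhκ (A ∩ {x | g x ≤ h x}))
    rw [withDensity_apply _ (hA.inter hB)]
    exact setLIntegral_congr_fun (hA.inter hB) fun x hx => sup_eq_right.2 hx.2
  · refine le_trans (le_of_eq ?_) (hgκ (A \ {x | g x ≤ h x}))
    rw [withDensity_apply _ (hA.diff hB)]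
    exact setLIntegral_congr_fun (hA.diff hB) fun x hx => sup_eq_left.2 (not_le.1 hx.2).le

/-- Two densities are compared by splitting along {g ≤ h}; partial suprema and monotone convergence
do the rest. Data processing can thus be checked one affine function at a time, provided it is
checked on every measurable set. -/
lemma withDensity_iSup_le {Ω : Type*} [MeasurableSpace Ω] {ρ κ : Measure Ω}
    {g : ℕ → Ω → ℝ≥0∞} (hg : ∀ n, Measurable (g n)) (h : ∀ n, ρ.withDensity (g n) ≤ κ) :
    ρ.withDensity (fun x => ⨆ n, g n x) ≤ κ := by
  have hp : ∀ n, Measurable (partialSups g n) ∧ ρ.withDensity (partialSups g n) ≤ κ := by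
    intro n
    induction n with
    | zero => simpa using ⟨hg 0, h 0⟩
    | succ n ih =>
      rw [partialSups_add_one]
      exact ⟨ih.1.sup (hg _), withDensity_sup_le ih.1 (hg _) ih.2 (h _)⟩
  have e : (fun x => ⨆ n, g n x) = fun x => ⨆ n, partialSups g n x := by
    have := iSup_partialSups_eq g
    funext x
    rw [← iSup_apply, ← this, iSup_apply]
  refine Measure.le_iff.2 fun A hA => ?_
  rw [withDensity_apply _ hA, e, lintegral_iSup (fun n => (hp n).1)
    (fun i j hij x => (partialSups g).monotone hij x)]
  refine iSup_le fun n => ?_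
  rw [← withDensity_apply _ hA]
  exact (hp n).2 A

lemma setLIntegral_rnDeriv_toNNReal {Ω : Type*} [MeasurableSpace Ω] {μ ν : Measure Ω}
    [IsFiniteMeasure μ] [SigmaFinite ν] (h : μ ≪ ν) (A : Set Ω) :
    ∫⁻ x in A, ((μ.rnDeriv ν x).toNNReal : ℝ≥0∞) ∂ν = μ A := by
  rw [← Measure.setLIntegral_rnDeriv h A]
  refine lintegral_congr_ae (ae_restrict_of_ae ?_)
  filter_upwards [Measure.rnDeriv_lt_top μ ν] with x hx
  exact ENNReal.coe_toNNReal hx.ne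

/-- The data processing inequality for a measurable map. -/
theorem lintegral_affineSup_rnDeriv_map_le {Ω Ω' : Type*} [MeasurableSpace Ω] [MeasurableSpace Ω']
    (α β : ℕ → ℝ) {μ ν : Measure Ω} [IsFiniteMeasure μ] [IsFiniteMeasure ν] (h : μ ≪ ν)
    {T : Ω → Ω'} (hT : Measurable T) :
    ∫⁻ y, affineSup α β (((μ.map T).rnDeriv (ν.map T) y).toNNReal) ∂(ν.map T)
      ≤ ∫⁻ x, affineSup α β ((μ.rnDeriv ν x).toNNReal) ∂ν := by
  have h' : μ.map T ≪ ν.map T := h.map hT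
  set r := fun x => (μ.rnDeriv ν x).toNNReal with hr
  set r' := fun y => ((μ.map T).rnDeriv (ν.map T) y).toNNReal with hr'
  have hrm : Measurable r := (Measure.measurable_rnDeriv _ _).ennreal_toNNReal
  have hrm' : Measurable r' := (Measure.measurable_rnDeriv _ _).ennreal_toNNReal
  have hgm : ∀ n, Measurable fun y => ENNReal.ofReal (α n * r' y + β n) := by
    intro n; fun_prop
  set κ := (ν.withDensity fun x => affineSup α β (r x)).map T with hκ
  have key : (ν.map T).withDensity (fun y => affineSup α β (r' y)) ≤ κ := by
    refine withDensity_iSup_le hgm fun n => Measure.le_iff.2 fun A hA => ?_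
    -- On B the positive part is the affine function itself, whose integrals over A ∩ B and over its
    -- preimage agree: both densities integrate to μ (T⁻¹ (A ∩ B)). This replaces conditional
    -- Jensen.
    set B := {y | 0 ≤ α n * (r' y : ℝ) + β n} with hB
    have hBm : MeasurableSet B := measurableSet_le measurable_const (by fun_prop)
    have hAB := hA.inter hBm
    have hpre := hT hAB
    have hr₁ : ∫⁻ x in T ⁻¹' (A ∩ B), r x ∂ν = (μ (T ⁻¹' (A ∩ B))).toNNReal := by
      rw [hr, setLIntegral_rnDeriv_toNNReal h, ENNReal.coe_toNNReal (measure_ne_top _ _)]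
    have hr₂ : ∫⁻ y in A ∩ B, r' y ∂(ν.map T) = (μ (T ⁻¹' (A ∩ B))).toNNReal := by
      rw [hr', setLIntegral_rnDeriv_toNNReal h', Measure.map_apply hT hAB,
        ENNReal.coe_toNNReal (measure_ne_top _ _)]
    obtain ⟨hi₁, he₁⟩ := integral_affine hrm hr₁ (α n) (β n)
    obtain ⟨hi₂, he₂⟩ := integral_affine hrm' hr₂ (α n) (β n)
    have e : ∫ y in A ∩ B, (α n * (r' y : ℝ) + β n) ∂(ν.map T)
        = ∫ x in T ⁻¹' (A ∩ B), (α n * (r x : ℝ) + β n) ∂ν := by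
      rw [he₁, he₂]
      simp [measureReal_def, Measure.map_apply hT hAB]
    have h0 : ∫⁻ y in A \ B, ENNReal.ofReal (α n * r' y + β n) ∂(ν.map T) = 0 := by
      rw [setLIntegral_congr_fun (g := fun _ => 0) (hA.diff hBm) fun y hy =>
        ENNReal.ofReal_of_nonpos (not_le.1 hy.2).le]
      simp
    rw [withDensity_apply _ hA, ← lintegral_inter_add_sdiff _ A hBm, h0, add_zero,
      ← ofReal_integral_eq_lintegral_ofReal hi₂
        ((ae_restrict_mem hAB).mono fun y hy => hy.2), e]
    calc _ ≤ ∫⁻ x in T ⁻¹' (A ∩ B), ENNReal.ofReal (α n * r x + β n) ∂ν :=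
          ofReal_integral_le_lintegral hi₁
      _ ≤ ∫⁻ x in T ⁻¹' (A ∩ B), affineSup α β (r x) ∂ν :=
          lintegral_mono fun x => ofReal_le_affineSup α β n _
      _ ≤ ∫⁻ x in T ⁻¹' A, affineSup α β (r x) ∂ν :=
          lintegral_mono_set (preimage_mono inter_subset_left)
      _ = κ A := by rw [hκ, Measure.map_apply hT hA, withDensity_apply _ (hT hA)]
  have := key univ
  rwa [withDensity_apply _ .univ, hκ, Measure.map_apply hT .univ, preimage_univ,
    withDensity_apply _ .univ, Measure.restrict_univ, Measure.restrict_univ] at this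

/-! ### Reduction of the divergences to [0, ∞]-valued quantities. -/

/-- Positive minus negative part of l + φ, rearranged without subtraction so that it can be
integrated even where φ = ∞. -/
lemma toENNReal_coe_add_balance (l : ℝ) (φ : ℝ≥0∞) :
    ((l : EReal) + (φ : EReal)).toENNReal + ENNReal.ofReal (-l)
      = φ + ENNReal.ofReal l + (-((l : EReal) + (φ : EReal))).toENNReal := by
  induction φ with
  | top => simp
  | coe m =>
    have e : (l : EReal) + ((m : ℝ≥0∞) : EReal) = ((l + m : ℝ) : EReal) := by
      rw [EReal.coe_add]; rfl
    rw [e, ← EReal.coe_neg, EReal.real_coe_toENNReal, EReal.real_coe_toENNReal,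
      ← ENNReal.ofReal_coe_nnreal]
    have hm := m.coe_nonneg
    rw [← ENNReal.toReal_eq_toReal_iff' (by finiteness) (by finiteness),
      ENNReal.toReal_add (by finiteness) (by finiteness),
      ENNReal.toReal_add (by finiteness) (by finiteness),
      ENNReal.toReal_add (by finiteness) (by finiteness)]
    simp only [ENNReal.toReal_ofReal']
    rcases le_total l 0 with h₁ | h₁ <;> rcases le_total (l + m) 0 with h₂ | h₂ <;>
      simp [h₁, h₂, -neg_add_rev] <;> linarith

lemma EReal.sub_eq_of_balance {P N L₁ L₂ Φ : ℝ≥0∞} (hN : N ≠ ⊤) (h₁ : L₁ ≠ ⊤) (h₂ : L₂ ≠ ⊤)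
    (h : P + L₂ = Φ + L₁ + N) :
    (P : EReal) - (N : EReal) = ((L₁.toReal - L₂.toReal : ℝ) : EReal) + (Φ : EReal) := by
  lift N to ℝ≥0 using hN
  lift L₁ to ℝ≥0 using h₁
  lift L₂ to ℝ≥0 using h₂
  induction Φ with
  | top =>
    have : P = ⊤ := by simpa using h
    subst this
    rw [EReal.coe_ennreal_top, EReal.coe_add_top]
    exact EReal.top_sub_coe _
  | coe φ =>
    have hP : P ≠ ⊤ := by
      rintro rfl
      have : (⊤ : ℝ≥0∞) = ((φ + L₁ + N : ℝ≥0) : ℝ≥0∞) := by push_cast; simpa using h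
      exact ENNReal.coe_ne_top this.symm
    lift P to ℝ≥0 using hP
    have h' : (P : ℝ) + L₂ = φ + L₁ + N := by exact_mod_cast h
    change ((P : ℝ) : EReal) - ((N : ℝ) : EReal) = _ + ((φ : ℝ) : EReal)
    rw [← EReal.coe_sub, ← EReal.coe_add]
    simp only [ENNReal.coe_toReal]
    congr 1
    linarith

lemma eintegral_affine_add {Ω : Type*} [MeasurableSpace Ω] {ν : Measure Ω}
    [IsProbabilityMeasure ν] {r : Ω → ℝ≥0} (hr : Measurable r) (hr₁ : ∫⁻ x, r x ∂ν = 1)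
    {φ : Ω → ℝ≥0∞} (hφ : Measurable φ) (a b : ℝ) :
    eintegral ν (fun x => ((a * r x + b : ℝ) : EReal) + (φ x : EReal))
      = ((a + b : ℝ) : EReal) + ((∫⁻ x, φ x ∂ν : ℝ≥0∞) : EReal) := by
  obtain ⟨hi, he⟩ := integral_affine hr (m := 1) (by simpa using hr₁) a b
  have hl : Measurable fun x => a * (r x : ℝ) + b := by fun_prop
  have h₁ : ∫⁻ x, ENNReal.ofReal (a * r x + b) ∂ν ≠ ⊤ := hi.lintegral_lt_top.ne
  have h₂ : ∫⁻ x, ENNReal.ofReal (-(a * r x + b)) ∂ν ≠ ⊤ := hi.neg.lintegral_lt_top.ne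
  have h := lintegral_congr (μ := ν) fun x => toENNReal_coe_add_balance (a * r x + b) (φ x)
  have hl' : Measurable fun x => ENNReal.ofReal (-(a * (r x : ℝ) + b)) := hl.neg.ennreal_ofReal
  have hφl : Measurable fun x => φ x + ENNReal.ofReal (a * (r x : ℝ) + b) :=
    hφ.add hl.ennreal_ofReal
  rw [lintegral_add_right _ hl', lintegral_add_left hφl, lintegral_add_left hφ] at h
  -- As φ ≥ 0, the negative part is dominated by that of the affine function, so the difference
  -- defining `eintegral` is never ∞ - ∞.
  have hN : ∫⁻ x, (-(((a * r x + b : ℝ) : EReal) + (φ x : EReal))).toENNReal ∂ν ≠ ⊤ := by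
    refine ne_top_of_le_ne_top h₂ (lintegral_mono fun x => ?_)
    rw [← EReal.real_coe_toENNReal, EReal.coe_neg]
    refine EReal.toENNReal_le_toENNReal (EReal.neg_le_neg_iff.2 ?_)
    exact le_add_of_nonneg_right (EReal.coe_ennreal_nonneg _)
  have hreal := integral_eq_lintegral_pos_part_sub_lintegral_neg_part hi
  rw [he, probReal_univ] at hreal
  rw [eintegral, EReal.sub_eq_of_balance hN h₁ h₂ h, ← hreal]
  simp

lemma eintegral_coe {Ω : Type*} [MeasurableSpace Ω] (ρ : Measure Ω) (X : Ω → ℝ≥0∞) :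
    eintegral ρ (fun x => (X x : EReal)) = ((∫⁻ x, X x ∂ρ : ℝ≥0∞) : EReal) := by
  have : ∀ x, (-(X x : EReal)).toENNReal = 0 := fun x =>
    EReal.toENNReal_of_nonpos (EReal.neg_le_zero.2 (EReal.coe_ennreal_nonneg _))
  simp only [eintegral, EReal.toENNReal_coe, this, lintegral_zero]
  simp

lemma EReal.coe_add_coe_ennreal_eq_sub {s : ℝ} {c X : ℝ≥0∞} (h : (s : EReal) + (c : EReal) = 0)
    (hcX : c ≤ X) : (s : EReal) + (X : EReal) = ((X - c : ℝ≥0∞) : EReal) := by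
  conv_lhs => rw [← tsub_add_cancel_of_le hcX, EReal.coe_ennreal_add, add_left_comm, h, add_zero]

/-- `f` vanishes at `1` and is the sum of `t ↦ a t + b` and of `affineSup α β`. -/
def HasAffineDecomposition (f : ℝ≥0 → EReal) (a b : ℝ) (α β : ℕ → ℝ) : Prop :=
  f 1 = 0 ∧ ∀ t : ℝ≥0, f t = ((a * t + b : ℝ) : EReal) + (affineSup α β t : EReal)

lemma HasAffineDecomposition.map_one {f : ℝ≥0 → EReal} {a b : ℝ} {α β : ℕ → ℝ}
    (hf : HasAffineDecomposition f a b α β) :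
    ((a + b : ℝ) : EReal) + (affineSup α β 1 : EReal) = 0 := by
  rw [← hf.1, hf.2]; simp

lemma HasAffineDecomposition.affineSup_one_ne_top {f : ℝ≥0 → EReal} {a b : ℝ} {α β : ℕ → ℝ}
    (hf : HasAffineDecomposition f a b α β) : affineSup α β 1 ≠ ⊤ := by
  intro h
  have := hf.map_one
  rw [h, EReal.coe_ennreal_top, EReal.coe_add_top] at this
  exact EReal.top_ne_zero this

/-- The integral of `affineSup α β` of the density of `μ` with respect to `ν`. -/
def affineSupDivergence {Ω : Type*} [MeasurableSpace Ω] (α β : ℕ → ℝ) (ν μ : Measure Ω) : ℝ≥0∞ :=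
  ∫⁻ x, affineSup α β ((μ.rnDeriv ν x).toNNReal) ∂ν

/-- The average of `affineSup α β` over the normalized pmf of the rank statistic. -/
def affineSupRankDivergence (α β : ℕ → ℝ) (K : ℕ) (ν μ : Measure ℝ) : ℝ≥0∞ :=
  ((K : ℝ≥0∞) + 1)⁻¹ *
    ∑ n ∈ Finset.range (K + 1), affineSup α β (((K : ℝ≥0) + 1) * rankPmf μ ν K n)

/-- Jensen with mean 1. It ensures that the truncated subtraction of `affineSup α β 1` is a true
one. -/
lemma affineSup_one_le_affineSupDivergence {Ω : Type*} [MeasurableSpace Ω] (α β : ℕ → ℝ)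
    {ν μ : Measure Ω} [IsProbabilityMeasure ν] [IsProbabilityMeasure μ] (h : μ ≪ ν) :
    affineSup α β 1 ≤ affineSupDivergence α β ν μ := by
  refine affineSup_le_lintegral α β (Measure.measurable_rnDeriv _ _).ennreal_toNNReal ?_
  have := setLIntegral_rnDeriv_toNNReal h univ
  simpa using this

lemma HasAffineDecomposition.fDivergence_eq {Ω : Type*} [MeasurableSpace Ω] {f : ℝ≥0 → EReal}
    {a b : ℝ} {α β : ℕ → ℝ} (hf : HasAffineDecomposition f a b α β) {ν μ : Measure Ω}
    [IsProbabilityMeasure ν] [IsProbabilityMeasure μ] (h : μ ≪ ν) :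
    fDivergence f ν μ = ((affineSupDivergence α β ν μ - affineSup α β 1 : ℝ≥0∞) : EReal) := by
  have hrm : Measurable fun x => (μ.rnDeriv ν x).toNNReal :=
    (Measure.measurable_rnDeriv _ _).ennreal_toNNReal
  have hr₁ := setLIntegral_rnDeriv_toNNReal h univ
  rw [Measure.restrict_univ, measure_univ] at hr₁
  rw [fDivergence, if_pos h]
  simp only [hf.2]
  rw [eintegral_affine_add hrm hr₁
      (φ := fun x => affineSup α β (μ.rnDeriv ν x).toNNReal) ((measurable_affineSup α β).comp hrm),
    ← EReal.coe_add_coe_ennreal_eq_sub hf.map_one (affineSup_one_le_affineSupDivergence α β h)]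
  rfl

lemma EReal.coe_ennreal_sum {ι : Type*} (s : Finset ι) (g : ι → ℝ≥0∞) :
    ((∑ i ∈ s, g i : ℝ≥0∞) : EReal) = ∑ i ∈ s, (g i : EReal) := by
  classical
  induction s using Finset.induction_on with
  | empty => simp
  | insert i s hi ih => rw [Finset.sum_insert hi, Finset.sum_insert hi, coe_ennreal_add, ih]

lemma EReal.coe_real_sum {ι : Type*} (s : Finset ι) (g : ι → ℝ) :
    ((∑ i ∈ s, g i : ℝ) : EReal) = ∑ i ∈ s, (g i : EReal) := by
  classical
  induction s using Finset.induction_on with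
  | empty => simp
  | insert i s hi ih => rw [Finset.sum_insert hi, Finset.sum_insert hi, coe_add, ih]

lemma affineSup_one_le_affineSupRankDivergence (α β : ℕ → ℝ) (K : ℕ) {ν μ : Measure ℝ}
    (hQ : ∑ n ∈ Finset.range (K + 1), rankPmf μ ν K n = 1) :
    affineSup α β 1 ≤ affineSupRankDivergence α β K ν μ :=
  affineSup_le_average α β K _ (by rw [← Finset.mul_sum, hQ, mul_one])

/-- The numbers (K + 1) Q n have average 1, so the affine part again contributes a + b. -/
lemma HasAffineDecomposition.rankDivergence_eq {f : ℝ≥0 → EReal} {a b : ℝ} {α β : ℕ → ℝ}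
    (hf : HasAffineDecomposition f a b α β) (K : ℕ) {ν μ : Measure ℝ}
    (hQ : ∑ n ∈ Finset.range (K + 1), rankPmf μ ν K n = 1) :
    rankDivergence f K ν μ
      = ((affineSupRankDivergence α β K ν μ - affineSup α β 1 : ℝ≥0∞) : EReal) := by
  have hK : (0 : ℝ) < (K : ℝ) + 1 := by positivity
  have e : ((((K : ℝ) + 1)⁻¹ : ℝ) : EReal) = ((((K : ℝ≥0∞) + 1)⁻¹ : ℝ≥0∞) : EReal) := by
    have : ((K : ℝ≥0∞) + 1)⁻¹ = ENNReal.ofReal (((K : ℝ) + 1)⁻¹) := by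
      rw [ENNReal.ofReal_inv_of_pos hK, ENNReal.ofReal_add (by positivity) zero_le_one]
      simp
    rw [this, EReal.coe_ennreal_ofReal, max_eq_left (by positivity)]
  have hQ' : ∑ n ∈ Finset.range (K + 1), (rankPmf μ ν K n : ℝ) = 1 := by exact_mod_cast hQ
  rw [← EReal.coe_add_coe_ennreal_eq_sub hf.map_one
    (affineSup_one_le_affineSupRankDivergence α β K hQ), rankDivergence]
  simp only [hf.2]
  rw [Finset.sum_add_distrib, EReal.left_distrib_of_nonneg_of_ne_top
    (by exact_mod_cast (inv_pos.2 hK).le) (EReal.coe_ne_top _), ← EReal.coe_real_sum,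
    ← EReal.coe_ennreal_sum, ← EReal.coe_mul]
  congr 1
  · congr 1
    push_cast
    rw [Finset.sum_add_distrib, ← Finset.mul_sum, ← Finset.mul_sum, hQ']
    simp
    field_simp
  · rw [e, ← EReal.coe_ennreal_mul]
    rfl

/-! ### Bernstein and beta weights. -/

/-- The Bernstein weight `C(K, n) u ^ n (1 - u) ^ (K - n)`. -/
def bernsteinWeight (K n : ℕ) (u : ℝ) : ℝ := K.choose n * u ^ n * (1 - u) ^ (K - n)

lemma bernsteinWeight_eq_eval (K n : ℕ) (u : ℝ) :
    bernsteinWeight K n u = (bernsteinPolynomial ℝ K n).eval u := by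
  simp [bernsteinWeight, bernsteinPolynomial]

@[fun_prop]
lemma continuous_bernsteinWeight (K n : ℕ) : Continuous (bernsteinWeight K n) := by
  unfold bernsteinWeight
  fun_prop

lemma bernsteinWeight_nonneg (K n : ℕ) {u : ℝ} (hu : u ∈ Icc (0 : ℝ) 1) :
    0 ≤ bernsteinWeight K n u := by
  have h₁ := hu.1
  have h₂ : 0 ≤ 1 - u := sub_nonneg.2 hu.2
  unfold bernsteinWeight
  positivity

lemma sum_bernsteinWeight (K : ℕ) (u : ℝ) :
    ∑ n ∈ Finset.range (K + 1), bernsteinWeight K n u = 1 := by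
  simp only [bernsteinWeight_eq_eval, ← Polynomial.eval_finsetSum, bernsteinPolynomial.sum,
    Polynomial.eval_one]

/-- The difference of the integrands is, up to the factor K + 1, the derivative of the weight of
index (K + 1, n + 1), which vanishes at 0, and at 1 because n < K. -/
lemma integral_bernsteinWeight_succ {K n : ℕ} (hn : n < K) :
    ∫ u in (0 : ℝ)..1, bernsteinWeight K (n + 1) u = ∫ u in (0 : ℝ)..1, bernsteinWeight K n u := by
  have h : ∫ u in (0 : ℝ)..1, ((K + 1 : ℝ) * (bernsteinWeight K n u - bernsteinWeight K (n + 1) u))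
      = 0 := by
    have hd : ∀ u ∈ uIcc (0 : ℝ) 1, HasDerivAt (bernsteinWeight (K + 1) (n + 1))
        ((K + 1 : ℝ) * (bernsteinWeight K n u - bernsteinWeight K (n + 1) u)) u := by
      intro u _
      have := (bernsteinPolynomial ℝ (K + 1) (n + 1)).hasDerivAt u
      rw [bernsteinPolynomial.derivative_succ] at this
      rw [funext (bernsteinWeight_eq_eval (K + 1) (n + 1)), bernsteinWeight_eq_eval,
        bernsteinWeight_eq_eval]
      simpa using this
    rw [intervalIntegral.integral_eq_sub_of_hasDerivAt hd
      (Continuous.intervalIntegrable (by fun_prop) _ _)]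
    have : K - n ≠ 0 := by omega
    simp [bernsteinWeight, this]
  rw [intervalIntegral.integral_const_mul, intervalIntegral.integral_sub
    (Continuous.intervalIntegrable (by fun_prop) _ _)
    (Continuous.intervalIntegrable (by fun_prop) _ _)] at h
  have hK : (K + 1 : ℝ) ≠ 0 := by positivity
  have := (mul_eq_zero.1 h).resolve_left hK
  linarith

/-- All these integrals coincide, and the one with n = K is that of u ^ K. -/
lemma integral_bernsteinWeight {K n : ℕ} (hn : n ≤ K) :
    ∫ u in (0 : ℝ)..1, bernsteinWeight K n u = ((K : ℝ) + 1)⁻¹ := by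
  have h : ∀ m ≤ K, ∫ u in (0 : ℝ)..1, bernsteinWeight K m u
      = ∫ u in (0 : ℝ)..1, bernsteinWeight K 0 u := by
    intro m
    induction m with
    | zero => simp
    | succ m ih => intro hm; rw [integral_bernsteinWeight_succ (by omega), ih (by omega)]
  rw [h n hn, ← h K le_rfl]
  simp [bernsteinWeight]

/-- The density of the law of the `(n + 1)`-st order statistic of `K + 1` uniform variables. -/
def betaWeight (K n : ℕ) (u : ℝ) : ℝ := (K + 1) * bernsteinWeight K n u

@[fun_prop]
lemma continuous_betaWeight (K n : ℕ) : Continuous (betaWeight K n) := by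
  unfold betaWeight
  fun_prop

lemma betaWeight_nonneg (K n : ℕ) {u : ℝ} (hu : u ∈ Icc (0 : ℝ) 1) : 0 ≤ betaWeight K n u :=
  mul_nonneg (by positivity) (bernsteinWeight_nonneg K n hu)

lemma integral_betaWeight {K n : ℕ} (hn : n ≤ K) :
    ∫ u in (0 : ℝ)..1, betaWeight K n u = 1 := by
  unfold betaWeight
  rw [intervalIntegral.integral_const_mul, integral_bernsteinWeight hn]
  field_simp

/-- Size-biasing a beta density gives the beta density with both indices raised by one; iteration
yields the moments. -/
lemma mul_betaWeight (K n : ℕ) (u : ℝ) :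
    u * betaWeight K n u = ((n : ℝ) + 1) / (K + 2) * betaWeight (K + 1) (n + 1) u := by
  have h : ((K : ℝ) + 1) * K.choose n = (K + 1).choose (n + 1) * (n + 1) := by
    exact_mod_cast Nat.add_one_mul_choose_eq K n
  have hK : (K : ℝ) + 2 ≠ 0 := by positivity
  simp only [betaWeight, bernsteinWeight, Nat.add_sub_add_right, pow_succ]
  push_cast
  field_simp
  linear_combination (K + 2 : ℝ) * u * u ^ n * (1 - u) ^ (K - n) * h

lemma integral_mul_betaWeight {K n : ℕ} (hn : n ≤ K) :
    ∫ u in (0 : ℝ)..1, u * betaWeight K n u = ((n : ℝ) + 1) / (K + 2) := by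
  simp_rw [mul_betaWeight]
  rw [intervalIntegral.integral_const_mul, integral_betaWeight (by omega), mul_one]

lemma integral_sq_mul_betaWeight {K n : ℕ} (hn : n ≤ K) :
    ∫ u in (0 : ℝ)..1, u ^ 2 * betaWeight K n u
      = ((n : ℝ) + 1) / (K + 2) * ((n + 2) / (K + 3)) := by
  have : ∀ u, u ^ 2 * betaWeight K n u
      = ((n : ℝ) + 1) / (K + 2) * (u * betaWeight (K + 1) (n + 1) u) := by
    intro u
    rw [sq, mul_assoc, mul_betaWeight]; ring
  simp_rw [this]
  rw [intervalIntegral.integral_const_mul, integral_mul_betaWeight (by omega)]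
  push_cast
  ring

lemma integral_sq_sub_mul_betaWeight {K n : ℕ} (hn : n ≤ K) (u : ℝ) :
    ∫ v in (0 : ℝ)..1, (v - u) ^ 2 * betaWeight K n v
      = ((n : ℝ) + 1) / (K + 2) * ((n + 2) / (K + 3)) - 2 * u * (((n : ℝ) + 1) / (K + 2))
        + u ^ 2 := by
  have : ∀ v, (v - u) ^ 2 * betaWeight K n v = v ^ 2 * betaWeight K n v
      - 2 * u * (v * betaWeight K n v) + u ^ 2 * betaWeight K n v := by
    intro v; ring
  simp_rw [this]
  rw [intervalIntegral.integral_add, intervalIntegral.integral_sub,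
    intervalIntegral.integral_const_mul, intervalIntegral.integral_const_mul,
    integral_sq_mul_betaWeight hn, integral_mul_betaWeight hn, integral_betaWeight hn, mul_one]
  all_goals exact Continuous.intervalIntegrable (by fun_prop) _ _

/-- Variance plus squared bias: the mean x = (n + 1) / (K + 2) is within 1 / (K + 2) of u, and each
term is at most 1 / (K + 2). The condition u < 1 forces n ≤ K. -/
lemma integral_sq_sub_mul_betaWeight_le {K : ℕ} {u : ℝ} (h₀ : 0 ≤ u) (h₁ : u < 1) :
    ∫ v in (0 : ℝ)..1, (v - u) ^ 2 * betaWeight K ⌊((K : ℝ) + 1) * u⌋₊ v ≤ 2 / (K + 2) := by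
  set n := ⌊((K : ℝ) + 1) * u⌋₊ with hn
  have hK : (0 : ℝ) ≤ K := Nat.cast_nonneg K
  have hn₁ : (n : ℝ) ≤ (K + 1) * u := Nat.floor_le (by positivity)
  have hn₂ : ((K : ℝ) + 1) * u < n + 1 := Nat.lt_floor_add_one _
  have hnK : n ≤ K := by
    have : (n : ℝ) < K + 1 := by nlinarith
    have : n < K + 1 := by exact_mod_cast this
    omega
  have hn0 : (0 : ℝ) ≤ n := Nat.cast_nonneg n
  have hnK' : (n : ℝ) ≤ K := by exact_mod_cast hnK
  rw [integral_sq_sub_mul_betaWeight hnK]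
  set x := ((n : ℝ) + 1) / (K + 2) with hx
  have hx0 : 0 ≤ x := by positivity
  have hx1 : x ≤ 1 := by rw [hx, div_le_one (by positivity)]; linarith
  have hd : ((n : ℝ) + 2) / (K + 3) - x ≤ 1 / (K + 2) := by
    rw [hx, div_sub_div _ _ (by positivity) (by positivity), div_le_div_iff₀ (by positivity)
      (by positivity)]
    nlinarith
  have hxu : |x - u| ≤ 1 / (K + 2) := by
    have e : x - u = (n + 1 - (K + 2) * u) / (K + 2) := by rw [hx]; field_simp
    rw [e, abs_div, abs_of_pos (show (0 : ℝ) < K + 2 by positivity)]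
    gcongr
    rw [abs_le]
    constructor <;> nlinarith
  have hsq : (x - u) ^ 2 ≤ 1 / (K + 2) := by
    rw [← sq_abs]
    have : (1 : ℝ) / (K + 2) ≤ 1 := by rw [div_le_one (by positivity)]; linarith
    nlinarith [abs_nonneg (x - u)]
  have hvar : x * (((n : ℝ) + 2) / (K + 3) - x) ≤ 1 / (K + 2) := by
    refine (mul_le_mul_of_nonneg_left hd hx0).trans ?_
    exact mul_le_of_le_one_left (by positivity) hx1
  have e2 : (2 : ℝ) / (K + 2) = 1 / (K + 2) + 1 / (K + 2) := by ring
  rw [e2]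
  nlinarith

/-- Continuity covers |v - u| < δ; farther away the quadratic term exceeds the trivial bound 2 M. A
second moment bound then suffices for convergence. -/
lemma exists_abs_sub_le_add_sq {r : ℝ → ℝ} (hr : ContinuousOn r (Icc 0 1)) {u : ℝ}
    (hu : u ∈ Icc (0 : ℝ) 1) {ε : ℝ} (hε : 0 < ε) :
    ∃ C, 0 ≤ C ∧ ∀ v ∈ Icc (0 : ℝ) 1, |r v - r u| ≤ ε + C * (v - u) ^ 2 := by
  obtain ⟨M, hM⟩ := isCompact_Icc.exists_bound_of_continuousOn hr
  obtain ⟨δ, hδ, h⟩ := Metric.continuousWithinAt_iff.1 (hr u hu) ε hε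
  have hM0 : 0 ≤ M := (norm_nonneg _).trans (hM u hu)
  refine ⟨2 * M / δ ^ 2, by positivity, fun v hv => ?_⟩
  rcases lt_or_ge (dist v u) δ with hd | hd
  · have := (h hv hd).le
    rw [Real.dist_eq] at this
    exact this.trans (le_add_of_nonneg_right (by positivity))
  · have h₁ : |r v - r u| ≤ 2 * M := by
      have := (norm_sub_le (r v) (r u)).trans (add_le_add (hM v hv) (hM u hu))
      rw [Real.norm_eq_abs] at this
      linarith
    have h₂ : δ ^ 2 ≤ (v - u) ^ 2 := by
      rw [← sq_abs (v - u), ← Real.dist_eq]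
      gcongr
    have h₃ : 2 * M ≤ 2 * M / δ ^ 2 * (v - u) ^ 2 := by
      rw [div_mul_eq_mul_div, le_div_iff₀ (by positivity)]
      gcongr
    linarith

lemma tendsto_integral_mul_betaWeight {r : ℝ → ℝ} (hr : ContinuousOn r (Icc 0 1)) {u : ℝ}
    (h₀ : 0 ≤ u) (h₁ : u < 1) :
    Tendsto (fun K : ℕ => ∫ v in (0 : ℝ)..1, betaWeight K ⌊((K : ℝ) + 1) * u⌋₊ v * r v) atTop
      (𝓝 (r u)) := by
  rw [Metric.tendsto_atTop]
  intro ε hε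
  obtain ⟨C, hC, h⟩ := exists_abs_sub_le_add_sq hr ⟨h₀, h₁.le⟩ (half_pos hε)
  obtain ⟨N, hN⟩ := exists_nat_gt (2 * C / (ε / 2))
  refine ⟨N, fun K hK => ?_⟩
  set n := ⌊((K : ℝ) + 1) * u⌋₊ with hn
  have hnK : n ≤ K := by
    have hn₁ : (n : ℝ) ≤ (K + 1) * u := Nat.floor_le (by positivity)
    have : (n : ℝ) < K + 1 := by nlinarith [(Nat.cast_nonneg K : (0 : ℝ) ≤ K)]
    have : n < K + 1 := by exact_mod_cast this
    omega
  have hr' : ContinuousOn r (uIcc 0 1) := by rwa [uIcc_of_le zero_le_one]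
  have hint : IntervalIntegrable (fun v => betaWeight K n v * r v) volume 0 1 :=
    ((continuous_betaWeight K n).continuousOn.mul hr').intervalIntegrable
  have hint' : IntervalIntegrable (fun v => betaWeight K n v * r u) volume 0 1 :=
    Continuous.intervalIntegrable (by fun_prop) _ _
  have e : (∫ v in (0 : ℝ)..1, betaWeight K n v * r v) - r u
      = ∫ v in (0 : ℝ)..1, betaWeight K n v * (r v - r u) := by
    have : ∫ v in (0 : ℝ)..1, betaWeight K n v * r u = r u := by
      rw [intervalIntegral.integral_mul_const, integral_betaWeight hnK, one_mul]
    simp_rw [mul_sub]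
    rw [intervalIntegral.integral_sub hint hint', this]
  rw [Real.dist_eq, e]
  have hbound : |∫ v in (0 : ℝ)..1, betaWeight K n v * (r v - r u)|
      ≤ ∫ v in (0 : ℝ)..1, (ε / 2 * betaWeight K n v + C * ((v - u) ^ 2 * betaWeight K n v)) := by
    rw [← Real.norm_eq_abs]
    refine intervalIntegral.norm_integral_le_of_norm_le zero_le_one (ae_of_all _ fun v hv => ?_)
      (Continuous.intervalIntegrable (by fun_prop) _ _)
    have hv' : v ∈ Icc (0 : ℝ) 1 := Ioc_subset_Icc_self hv
    have hb := betaWeight_nonneg K n hv'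
    rw [norm_mul, Real.norm_of_nonneg hb, Real.norm_eq_abs]
    refine (mul_le_mul_of_nonneg_left (h v hv') hb).trans (le_of_eq ?_)
    ring
  rw [intervalIntegral.integral_add (Continuous.intervalIntegrable (by fun_prop) _ _)
    (Continuous.intervalIntegrable (by fun_prop) _ _), intervalIntegral.integral_const_mul,
    intervalIntegral.integral_const_mul, integral_betaWeight hnK] at hbound
  have h2 := mul_le_mul_of_nonneg_left (integral_sq_sub_mul_betaWeight_le (K := K) h₀ h₁) hC
  have h3 : C * (2 / ((K : ℝ) + 2)) < ε / 2 := by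
    have hKN : (N : ℝ) ≤ K := by exact_mod_cast hK
    rw [div_lt_iff₀ (by positivity)] at hN
    rw [mul_div_assoc', div_lt_iff₀ (by positivity)]
    nlinarith
  linarith

end

noncomputable section

open ProbabilityTheory

/-! ### The rank pmf. -/

lemma measurable_rankStatistic (K : ℕ) :
    Measurable fun p : ℝ × (Fin K → ℝ) => rankStatistic p.1 p.2 := by
  simp only [rankStatistic, Finset.card_filter]
  refine Finset.measurable_sum _ fun j _ => Measurable.ite ?_ measurable_const measurable_const
  exact measurableSet_le (by fun_prop) (by fun_prop)

lemma ofReal_cdf_eq (ν : Measure ℝ) [IsProbabilityMeasure ν] (y : ℝ) :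
    ν (Iic y) = ENNReal.ofReal (cdf ν y) ∧ ν (Ioi y) = ENNReal.ofReal (1 - cdf ν y) := by
  have h : ν (Iic y) = ENNReal.ofReal (cdf ν y) := (ofReal_cdf ν y).symm
  refine ⟨h, ?_⟩
  rw [← compl_Iic, prob_compl_eq_one_sub measurableSet_Iic, h,
    ENNReal.ofReal_sub _ (cdf_nonneg ν y), ENNReal.ofReal_one]

lemma cdf_mem_Icc (ν : Measure ℝ) (y : ℝ) : cdf ν y ∈ Icc (0 : ℝ) 1 :=
  ⟨cdf_nonneg ν y, cdf_le_one ν y⟩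

/-- The count is binomial: `B s` is the event that exactly the indices in s have z j ≤ y. -/
lemma pi_rankStatistic_eq (ν : Measure ℝ) [IsProbabilityMeasure ν] (K n : ℕ) (y : ℝ) :
    Measure.pi (fun _ : Fin K => ν) {z | rankStatistic y z = n}
      = ENNReal.ofReal (bernsteinWeight K n (cdf ν y)) := by
  classical
  set B : Finset (Fin K) → Set (Fin K → ℝ) := fun s =>
    univ.pi fun j => if j ∈ s then Iic y else Ioi y with hB
  have hmem : ∀ (s : Finset (Fin K)) (z : Fin K → ℝ),
      z ∈ B s ↔ (Finset.univ.filter fun j => z j ≤ y) = s := by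
    intro s z
    simp only [hB, mem_univ_pi, Finset.ext_iff, Finset.mem_filter, Finset.mem_univ, true_and]
    refine forall_congr' fun j => ?_
    by_cases hj : j ∈ s <;> simp [hj]
  have hset : {z : Fin K → ℝ | rankStatistic y z = n}
      = ⋃ s ∈ Finset.powersetCard n (Finset.univ : Finset (Fin K)), B s := by
    ext z
    simp only [mem_ofPred_eq, mem_iUnion, hmem, Finset.mem_powersetCard, Finset.subset_univ,
      true_and, rankStatistic, exists_prop, exists_eq_right']
  have hdisj : (Finset.powersetCard n (Finset.univ : Finset (Fin K)) :
      Set (Finset (Fin K))).PairwiseDisjoint B := by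
    intro s _ t _ hst
    refine disjoint_left.2 fun z hs ht => hst ?_
    rw [← (hmem s z).1 hs, (hmem t z).1 ht]
  have hmeas : ∀ s, MeasurableSet (B s) := by
    intro s
    refine MeasurableSet.univ_pi fun j => ?_
    split_ifs
    · exact measurableSet_Iic
    · exact measurableSet_Ioi
  rw [hset, measure_biUnion_finset hdisj fun s _ => hmeas s]
  have hval : ∀ s ∈ Finset.powersetCard n (Finset.univ : Finset (Fin K)),
      Measure.pi (fun _ : Fin K => ν) (B s)
        = ENNReal.ofReal (cdf ν y ^ n * (1 - cdf ν y) ^ (K - n)) := by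
    intro s hs
    have hcard : s.card = n := (Finset.mem_powersetCard.1 hs).2
    have h1 := cdf_nonneg ν y
    have h2 : 0 ≤ 1 - cdf ν y := sub_nonneg.2 (cdf_le_one ν y)
    rw [hB, Measure.pi_pi]
    have : ∀ j, ν (if j ∈ s then Iic y else Ioi y) = if j ∈ s then
        ENNReal.ofReal (cdf ν y) else ENNReal.ofReal (1 - cdf ν y) := by
      intro j
      split_ifs
      · exact (ofReal_cdf_eq ν y).1
      · exact (ofReal_cdf_eq ν y).2
    simp_rw [this]
    rw [Finset.prod_ite, Finset.prod_const, Finset.prod_const, Finset.filter_not,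
      Finset.filter_mem_eq_inter, Finset.univ_inter, ← Finset.compl_eq_univ_sdiff,
      Finset.card_compl, hcard, Fintype.card_fin, ENNReal.ofReal_mul (by positivity),
      ENNReal.ofReal_pow h1, ENNReal.ofReal_pow h2]
  rw [Finset.sum_congr rfl hval, Finset.sum_const, Finset.card_powersetCard, Finset.card_univ,
    Fintype.card_fin, nsmul_eq_mul, bernsteinWeight, mul_assoc,
    ENNReal.ofReal_mul (Nat.cast_nonneg (K.choose n)), ENNReal.ofReal_natCast]

lemma measurable_cdf (ν : Measure ℝ) : Measurable (cdf ν) := (monotone_cdf ν).measurable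

lemma coe_rankPmf (μ ν : Measure ℝ) [IsProbabilityMeasure μ] [IsProbabilityMeasure ν] (K n : ℕ) :
    (rankPmf μ ν K n : ℝ≥0∞)
      = (μ.prod (Measure.pi fun _ : Fin K => ν)) {p | rankStatistic p.1 p.2 = n} :=
  ENNReal.coe_toNNReal (measure_ne_top _ _)

lemma rankPmf_eq_lintegral (μ ν : Measure ℝ) [IsProbabilityMeasure μ] [IsProbabilityMeasure ν]
    (K n : ℕ) : (rankPmf μ ν K n : ℝ≥0∞)
      = ∫⁻ y, ENNReal.ofReal (bernsteinWeight K n (cdf ν y)) ∂μ := by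
  have hm : MeasurableSet {p : ℝ × (Fin K → ℝ) | rankStatistic p.1 p.2 = n} :=
    measurable_rankStatistic K (measurableSet_singleton n)
  rw [coe_rankPmf, Measure.prod_apply hm]
  exact lintegral_congr fun y => pi_rankStatistic_eq ν K n y

lemma sum_rankPmf (μ ν : Measure ℝ) [IsProbabilityMeasure μ] [IsProbabilityMeasure ν] (K : ℕ) :
    ∑ n ∈ Finset.range (K + 1), rankPmf μ ν K n = 1 := by
  have hm : ∀ n ∈ Finset.range (K + 1),
      Measurable fun y => ENNReal.ofReal (bernsteinWeight K n (cdf ν y)) := fun n _ =>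
    ((continuous_bernsteinWeight K n).measurable.comp (measurable_cdf ν)).ennreal_ofReal
  rw [← ENNReal.coe_inj, ENNReal.ofNNReal_finsetSum]
  simp_rw [rankPmf_eq_lintegral]
  rw [← lintegral_finsetSum _ hm]
  have : ∀ y, ∑ n ∈ Finset.range (K + 1), ENNReal.ofReal (bernsteinWeight K n (cdf ν y)) = 1 := by
    intro y
    rw [← ENNReal.ofReal_sum_of_nonneg fun n _ => bernsteinWeight_nonneg K n (cdf_mem_Icc ν y),
      sum_bernsteinWeight, ENNReal.ofReal_one]
  simp [this]

/-! ### Quantile function. -/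

/-- Right continuity of the cdf makes the infimum attained; 0 < u < 1 makes the set nonempty and
bounded below. -/
lemma quantile_le_iff (ν : Measure ℝ) [IsProbabilityMeasure ν] {u : ℝ} (hu : u ∈ Ioo (0 : ℝ) 1)
    (x : ℝ) : quantile ν u ≤ x ↔ u ≤ cdf ν x := by
  set S := {x : ℝ | u ≤ cdf ν x} with hS
  have hne : S.Nonempty := ((tendsto_cdf_atTop ν).eventually (eventually_ge_nhds hu.2)).exists
  have hbdd : BddBelow S := by
    obtain ⟨z, hz⟩ := ((tendsto_cdf_atBot ν).eventually (eventually_lt_nhds hu.1)).exists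
    refine ⟨z, fun y hy => ?_⟩
    by_contra! hlt
    exact absurd (hy.trans (monotone_cdf ν hlt.le)) (not_le.2 hz)
  refine ⟨fun h => ?_, fun h => csInf_le hbdd h⟩
  have hgt : ∀ y, x < y → u ≤ cdf ν y := by
    intro y hy
    obtain ⟨z, hz, hzy⟩ := exists_lt_of_csInf_lt hne (h.trans_lt hy)
    exact le_trans (show u ≤ cdf ν z from hz) (monotone_cdf ν hzy.le)
  have hc := ((cdf ν).right_continuous x).mono Ioi_subset_Ici_self
  exact ge_of_tendsto hc (eventually_mem_nhdsWithin.mono fun y hy => hgt y hy)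

lemma monotoneOn_quantile (ν : Measure ℝ) [IsProbabilityMeasure ν] :
    MonotoneOn (quantile ν) (Ioo 0 1) := by
  intro u hu v hv huv
  rw [quantile_le_iff ν hu]
  exact huv.trans ((quantile_le_iff ν hv _).1 le_rfl)

lemma aemeasurable_quantile (ν : Measure ℝ) [IsProbabilityMeasure ν] :
    AEMeasurable (quantile ν) (volume.restrict (Ioo 0 1)) :=
  aemeasurable_restrict_of_monotoneOn measurableSet_Ioo (monotoneOn_quantile ν)

/-- The quantile function pushes the uniform distribution forward to `ν`. -/
lemma map_quantile (ν : Measure ℝ) [IsProbabilityMeasure ν] :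
    (volume.restrict (Ioo (0 : ℝ) 1)).map (quantile ν) = ν := by
  have hfin : IsFiniteMeasure ((volume.restrict (Ioo (0 : ℝ) 1)).map (quantile ν)) := by
    infer_instance
  refine Measure.ext_of_Iic _ _ fun x => ?_
  rw [Measure.map_apply_of_aemeasurable (aemeasurable_quantile ν) measurableSet_Iic,
    (ofReal_cdf_eq ν x).1, Measure.restrict_apply' measurableSet_Ioo]
  have hset : quantile ν ⁻¹' Iic x ∩ Ioo 0 1 = Ioo 0 1 ∩ Iic (cdf ν x) := by
    ext u
    constructor
    · rintro ⟨h, hu⟩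
      exact ⟨hu, (quantile_le_iff ν hu x).1 h⟩
    · rintro ⟨hu, h⟩
      exact ⟨(quantile_le_iff ν hu x).2 h, hu⟩
  rw [hset]
  apply le_antisymm
  · refine (measure_mono (t := Icc 0 (cdf ν x)) fun u hu => ⟨hu.1.1.le, hu.2⟩).trans ?_
    rw [Real.volume_Icc, sub_zero]
  · refine le_trans ?_ (measure_mono (s := Ioo 0 (cdf ν x)) fun u hu =>
      ⟨⟨hu.1, hu.2.trans_le (cdf_le_one ν x)⟩, hu.2.le⟩)
    rw [Real.volume_Ioo, sub_zero]

/-- Left of the quantile the cdf is below u, and without atoms it does not jump there. -/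
lemma cdf_quantile {ν : Measure ℝ} [IsProbabilityMeasure ν] (hν : ∀ x, ν {x} = 0) {u : ℝ}
    (hu : u ∈ Ioo (0 : ℝ) 1) : cdf ν (quantile ν u) = u := by
  refine le_antisymm ?_ ((quantile_le_iff ν hu _).1 le_rfl)
  have h : (cdf ν).measure {quantile ν u} = 0 := by rw [measure_cdf, hν]
  rw [StieltjesFunction.measure_singleton, ENNReal.ofReal_eq_zero,
    sub_nonpos] at h
  refine h.trans ?_
  refine le_of_tendsto ((monotone_cdf ν).tendsto_leftLim _) ?_
  refine eventually_mem_nhdsWithin.mono fun y hy => ?_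
  by_contra! hlt
  exact absurd ((quantile_le_iff ν hu y).2 hlt.le) (not_le.2 hy)

lemma lintegral_eq_lintegral_quantile (ν : Measure ℝ) [IsProbabilityMeasure ν] {g : ℝ → ℝ≥0∞}
    (hg : Measurable g) : ∫⁻ y, g y ∂ν = ∫⁻ u in Ioo (0 : ℝ) 1, g (quantile ν u) := by
  conv_lhs => rw [← map_quantile ν]
  exact lintegral_map' hg.aemeasurable (aemeasurable_quantile ν)

/-! ### Univariate comparison and limit. -/

lemma measurable_betaWeight_cdf (ν : Measure ℝ) (K n : ℕ) :
    Measurable fun y => ENNReal.ofReal (betaWeight K n (cdf ν y)) :=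
  ((continuous_betaWeight K n).measurable.comp (measurable_cdf ν)).ennreal_ofReal

lemma lintegral_betaWeight_cdf {ν : Measure ℝ} [IsProbabilityMeasure ν] (hν : ∀ x, ν {x} = 0)
    {K n : ℕ} (hn : n ≤ K) : ∫⁻ y, ENNReal.ofReal (betaWeight K n (cdf ν y)) ∂ν = 1 := by
  rw [lintegral_eq_lintegral_quantile ν (measurable_betaWeight_cdf ν K n),
    setLIntegral_congr_fun (g := fun u => ENNReal.ofReal (betaWeight K n u)) measurableSet_Ioo
      fun u hu => by rw [cdf_quantile hν hu], restrict_Ioo_eq_restrict_Ioc,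
    ← ofReal_integral_eq_lintegral_ofReal, ← intervalIntegral.integral_of_le zero_le_one,
    integral_betaWeight hn, ENNReal.ofReal_one]
  · exact (continuous_betaWeight K n).integrableOn_Ioc
  · exact (ae_restrict_mem measurableSet_Ioc).mono fun u hu =>
      betaWeight_nonneg K n (Ioc_subset_Icc_self hu)

lemma mul_rankPmf_eq_lintegral {μ ν : Measure ℝ} [IsProbabilityMeasure μ]
    [IsProbabilityMeasure ν] (h : μ ≪ ν) (K n : ℕ) :
    ((((K : ℝ≥0) + 1) * rankPmf μ ν K n : ℝ≥0) : ℝ≥0∞)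
      = ∫⁻ y, ENNReal.ofReal (betaWeight K n (cdf ν y)) * ((μ.rnDeriv ν y).toNNReal : ℝ≥0∞) ∂ν := by
  have hm := ((continuous_bernsteinWeight K n).measurable.comp (measurable_cdf ν)).ennreal_ofReal
  simp only [Function.comp_def] at hm
  have e : ∀ u : ℝ, ENNReal.ofReal (betaWeight K n u)
      = ((K : ℝ≥0∞) + 1) * ENNReal.ofReal (bernsteinWeight K n u) := by
    intro u
    rw [betaWeight, ENNReal.ofReal_mul (by positivity),
      ENNReal.ofReal_add (by positivity) zero_le_one]
    simp
  rw [ENNReal.coe_mul, rankPmf_eq_lintegral, ← lintegral_rnDeriv_mul h hm.aemeasurable]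
  simp_rw [e, mul_assoc]
  rw [lintegral_const_mul' _ _ (by finiteness)]
  push_cast
  congr 1
  refine lintegral_congr_ae ?_
  filter_upwards [Measure.rnDeriv_lt_top μ ν] with y hy
  rw [ENNReal.coe_toNNReal hy.ne, mul_comm]

lemma sum_betaWeight (K : ℕ) {u : ℝ} (hu : u ∈ Icc (0 : ℝ) 1) :
    ∑ n ∈ Finset.range (K + 1), ENNReal.ofReal (betaWeight K n u) = (K : ℝ≥0∞) + 1 := by
  rw [← ENNReal.ofReal_sum_of_nonneg fun n _ => betaWeight_nonneg K n hu]
  simp only [betaWeight]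
  rw [← Finset.mul_sum, sum_bernsteinWeight, mul_one,
    ENNReal.ofReal_add (by positivity) zero_le_one]
  simp

/-- The univariate rank-statistic divergence is bounded by the divergence. -/
theorem affineSupRankDivergence_le (α β : ℕ → ℝ) (K : ℕ) {μ ν : Measure ℝ}
    [IsProbabilityMeasure μ] [IsProbabilityMeasure ν] (h : μ ≪ ν) (hν : ∀ x, ν {x} = 0) :
    affineSupRankDivergence α β K ν μ ≤ affineSupDivergence α β ν μ := by
  set w : ℕ → ℝ → ℝ≥0∞ := fun n y => ENNReal.ofReal (betaWeight K n (cdf ν y)) with hw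
  have hwm : ∀ n, Measurable (w n) := measurable_betaWeight_cdf ν K
  set r : ℝ → ℝ≥0 := fun y => (μ.rnDeriv ν y).toNNReal with hr
  have hrm : Measurable r := (Measure.measurable_rnDeriv _ _).ennreal_toNNReal
  have hφ : Measurable fun y => affineSup α β (r y) := (measurable_affineSup α β).comp hrm
  have hle : ∀ n ∈ Finset.range (K + 1), affineSup α β (((K : ℝ≥0) + 1) * rankPmf μ ν K n)
      ≤ ∫⁻ y, w n y * affineSup α β (r y) ∂ν := by
    intro n hn
    have hnK : n ≤ K := by simpa [Nat.lt_succ_iff] using hn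
    -- Jensen is applied under the law of density `w n`, for which the mean of dμ/dν is (K + 1) Q n.
    have hP : IsProbabilityMeasure (ν.withDensity (w n)) :=
      ⟨by rw [withDensity_apply _ .univ, Measure.restrict_univ, lintegral_betaWeight_cdf hν hnK]⟩
    refine (affineSup_le_lintegral α β (P := ν.withDensity (w n)) hrm ?_).trans_eq ?_
    · rw [lintegral_withDensity_eq_lintegral_mul _ (hwm n) hrm.coe_nnreal_ennreal,
        mul_rankPmf_eq_lintegral h]
      rfl
    · rw [lintegral_withDensity_eq_lintegral_mul _ (hwm n) hφ]
      rfl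
  rw [affineSupRankDivergence, mul_comm _⁻¹, ← div_eq_mul_inv]
  refine ENNReal.div_le_of_le_mul' ((Finset.sum_le_sum hle).trans_eq ?_)
  have hwφ : ∀ n ∈ Finset.range (K + 1), Measurable fun y => w n y * affineSup α β (r y) :=
    fun n _ => (hwm n).mul hφ
  rw [← lintegral_finsetSum _ hwφ, affineSupDivergence,
    ← lintegral_const_mul _ hφ]
  refine lintegral_congr fun y => ?_
  -- The weights sum pointwise to K + 1, cancelling the normalization of the average.
  rw [← Finset.sum_mul, sum_betaWeight K (cdf_mem_Icc ν y)]

lemma volume_floor_eq {K n : ℕ} (hn : n ≤ K) :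
    volume ({u : ℝ | ⌊((K : ℝ) + 1) * u⌋₊ = n} ∩ Ioo 0 1) = ((K : ℝ≥0∞) + 1)⁻¹ := by
  have hK : (0 : ℝ) < (K : ℝ) + 1 := by positivity
  have e : ((K : ℝ≥0∞) + 1)⁻¹
      = ENNReal.ofReal (((n : ℝ) + 1) / (K + 1) - (n : ℝ) / (K + 1)) := by
    rw [← sub_div, add_sub_cancel_left, one_div, ENNReal.ofReal_inv_of_pos hK,
      ENNReal.ofReal_add (by positivity) zero_le_one]
    simp
  have hnK : (n : ℝ) ≤ K := by exact_mod_cast hn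
  rw [e]
  apply le_antisymm
  · rw [← Real.volume_Icc]
    refine measure_mono fun u hu => ?_
    obtain ⟨h₁, h₂⟩ := (Nat.floor_eq_iff (mul_nonneg hK.le hu.2.1.le)).1 hu.1
    rw [mem_Icc, div_le_iff₀ hK, le_div_iff₀ hK]
    constructor <;> linarith
  · rw [← Real.volume_Ioo]
    refine measure_mono fun u hu => ?_
    rw [mem_Ioo, div_lt_iff₀ hK, lt_div_iff₀ hK] at hu
    have hn0 : (0 : ℝ) ≤ n := Nat.cast_nonneg n
    have hu0 : 0 < u := by
      by_contra! hle
      nlinarith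
    refine ⟨(Nat.floor_eq_iff (mul_nonneg hK.le hu0.le)).2 ⟨by linarith, by linarith⟩, hu0, ?_⟩
    by_contra! hle
    nlinarith

/-- The average over ranks becomes the integral of a step function on the fixed space (0, 1), where
Fatou applies. -/
lemma lintegral_floor (K : ℕ) (h : ℕ → ℝ≥0∞) :
    ∫⁻ u in Ioo (0 : ℝ) 1, h ⌊((K : ℝ) + 1) * u⌋₊
      = ((K : ℝ≥0∞) + 1)⁻¹ * ∑ n ∈ Finset.range (K + 1), h n := by
  have hm : ∀ n : ℕ, MeasurableSet {u : ℝ | ⌊((K : ℝ) + 1) * u⌋₊ = n} := fun n =>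
    (Nat.measurable_floor.comp (measurable_const_mul _)) (measurableSet_singleton n)
  have e : ∀ u ∈ Ioo (0 : ℝ) 1, h ⌊((K : ℝ) + 1) * u⌋₊ = ∑ n ∈ Finset.range (K + 1),
      {u : ℝ | ⌊((K : ℝ) + 1) * u⌋₊ = n}.indicator (fun _ => h n) u := by
    intro u hu
    have hlt : ⌊((K : ℝ) + 1) * u⌋₊ < K + 1 := by
      have hK : (0 : ℝ) < (K : ℝ) + 1 := by positivity
      rw [Nat.floor_lt (mul_nonneg hK.le hu.1.le)]
      push_cast
      nlinarith [hu.2]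
    rw [Finset.sum_eq_single ⌊((K : ℝ) + 1) * u⌋₊]
    · rw [indicator_of_mem]; rfl
    · intro n _ hne
      exact indicator_of_notMem (fun h' => hne h'.symm) _
    · intro hnot
      exact absurd (Finset.mem_range.2 hlt) hnot
  rw [setLIntegral_congr_fun measurableSet_Ioo e,
    lintegral_finsetSum _ fun n _ => measurable_const.indicator (hm n), Finset.mul_sum]
  refine Finset.sum_congr rfl fun n hn => ?_
  rw [lintegral_indicator_const (hm n), Measure.restrict_apply (hm n),
    volume_floor_eq (by simpa [Nat.lt_succ_iff] using hn), mul_comm]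

lemma mul_rankPmf_eq_integral {μ ν : Measure ℝ} [IsProbabilityMeasure μ]
    [IsProbabilityMeasure ν] (h : μ ≪ ν) (hν : ∀ x, ν {x} = 0) {r : ℝ → ℝ}
    (hrc : ContinuousOn r (Icc 0 1))
    (hr : ∀ᵐ u ∂(volume.restrict (Ioo (0 : ℝ) 1)), quantileRatio μ ν u = r u) (K n : ℕ) :
    ((K : ℝ≥0) + 1) * rankPmf μ ν K n
      = (∫ u in (0 : ℝ)..1, betaWeight K n u * r u).toNNReal := by
  have hrm : Measurable fun y => ((μ.rnDeriv ν y).toNNReal : ℝ≥0∞) :=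
    (Measure.measurable_rnDeriv _ _).ennreal_toNNReal.coe_nnreal_ennreal
  rw [← ENNReal.coe_inj, mul_rankPmf_eq_lintegral h, lintegral_eq_lintegral_quantile ν
    (g := fun y => ENNReal.ofReal (betaWeight K n (cdf ν y)) * ((μ.rnDeriv ν y).toNNReal : ℝ≥0∞))
    ((measurable_betaWeight_cdf ν K n).mul hrm)]
  have e : ∀ᵐ u ∂(volume.restrict (Ioo (0 : ℝ) 1)),
      ENNReal.ofReal (betaWeight K n (cdf ν (quantile ν u)))
        * ((μ.rnDeriv ν (quantile ν u)).toNNReal : ℝ≥0∞)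
        = ENNReal.ofReal (betaWeight K n u * r u) ∧ 0 ≤ betaWeight K n u * r u := by
    filter_upwards [hr, ae_restrict_mem measurableSet_Ioo] with u hu hmem
    have hb := betaWeight_nonneg K n (Ioo_subset_Icc_self hmem)
    have h0 : 0 ≤ r u := by rw [← hu]; exact ENNReal.toReal_nonneg
    rw [cdf_quantile hν hmem, ENNReal.ofReal_mul hb, ← hu]
    refine ⟨?_, by rw [hu]; positivity⟩
    congr 1
    rw [quantileRatio, ENNReal.ofReal]
    congr 1
    exact (Real.toNNReal_coe).symm
  rw [lintegral_congr_ae (e.mono fun u hu => hu.1), ← ofReal_integral_eq_lintegral_ofReal,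
    intervalIntegral.integral_of_le zero_le_one, ← restrict_Ioo_eq_restrict_Ioc]
  · rfl
  · exact (((continuous_betaWeight K n).continuousOn.mul hrc).integrableOn_Icc).mono_set
      Ioo_subset_Icc_self
  · exact e.mono fun u hu => hu.2

/-- The univariate rank-statistic divergences are asymptotically at least the divergence if the
quantile ratio is continuous. -/
theorem affineSupDivergence_le_liminf (α β : ℕ → ℝ) {μ ν : Measure ℝ}
    [IsProbabilityMeasure μ] [IsProbabilityMeasure ν] (h : μ ≪ ν) (hν : ∀ x, ν {x} = 0)
    (hc : HasContinuousQuantileRatio μ ν) :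
    affineSupDivergence α β ν μ
      ≤ liminf (fun K => affineSupRankDivergence α β K ν μ) atTop := by
  obtain ⟨r, hrc, hr⟩ := hc
  set g : ℕ → ℝ → ℝ≥0∞ := fun K u =>
    affineSup α β (((K : ℝ≥0) + 1) * rankPmf μ ν K ⌊((K : ℝ) + 1) * u⌋₊) with hg
  have hgm : ∀ K, Measurable (g K) := fun K =>
    (measurable_from_nat (f := fun n => affineSup α β (((K : ℝ≥0) + 1) * rankPmf μ ν K n))).comp
      (Nat.measurable_floor.comp (measurable_const_mul ((K : ℝ) + 1)))
  have hφ : Measurable fun y => affineSup α β ((μ.rnDeriv ν y).toNNReal) :=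
    (measurable_affineSup α β).comp (Measure.measurable_rnDeriv _ _).ennreal_toNNReal
  calc affineSupDivergence α β ν μ
      = ∫⁻ u in Ioo (0 : ℝ) 1, affineSup α β ((μ.rnDeriv ν (quantile ν u)).toNNReal) :=
        lintegral_eq_lintegral_quantile ν hφ
    _ ≤ ∫⁻ u in Ioo (0 : ℝ) 1, liminf (fun K => g K u) atTop := by
        refine lintegral_mono_ae ?_
        filter_upwards [hr, ae_restrict_mem measurableSet_Ioo] with u hu hmem
        have e : (μ.rnDeriv ν (quantile ν u)).toNNReal = (r u).toNNReal := by
          rw [← hu]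
          exact (Real.toNNReal_coe).symm
        have ht : Tendsto
            (fun K : ℕ => ((K : ℝ≥0) + 1) * rankPmf μ ν K ⌊((K : ℝ) + 1) * u⌋₊) atTop
            (𝓝 (r u).toNNReal) := by
          simp_rw [mul_rankPmf_eq_integral h hν hrc hr]
          exact (continuous_real_toNNReal.tendsto _).comp
            (tendsto_integral_mul_betaWeight hrc hmem.1.le hmem.2)
        rw [e]
        -- `affineSup` need not be continuous; lower semicontinuity along the convergent arguments
        -- gives the inequality needed.
        refine le_of_forall_lt fun y hy => ?_
        obtain ⟨z, hyz, hz⟩ := exists_between hy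
        refine hyz.trans_le (le_liminf_of_le (by isBoundedDefault) ?_)
        exact (ht.eventually (lowerSemicontinuous_affineSup α β _ z hz)).mono fun K hK => hK.le
    _ ≤ liminf (fun K => ∫⁻ u in Ioo (0 : ℝ) 1, g K u) atTop := lintegral_liminf_le hgm
    _ = liminf (fun K => affineSupRankDivergence α β K ν μ) atTop := by
        congr 1
        funext K
        exact lintegral_floor K fun n => affineSup α β (((K : ℝ≥0) + 1) * rankPmf μ ν K n)

/-! ### The sphere and the projections. -/

lemma isProbabilityMeasure_sphereUniform {d : ℕ} (hd : 1 ≤ d) :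
    IsProbabilityMeasure (sphereUniform d) := by
  have : Nonempty (Fin d) := ⟨⟨0, hd⟩⟩
  have : Nontrivial (EuclideanSpace ℝ (Fin d)) := by
    have : 0 < Module.finrank ℝ (EuclideanSpace ℝ (Fin d)) := by
      rw [finrank_euclideanSpace_fin]; exact hd
    exact Module.nontrivial_of_finrank_pos this
  refine ⟨?_⟩
  rw [sphereUniform, Measure.smul_apply, smul_eq_mul]
  refine ENNReal.inv_mul_cancel ?_ (measure_ne_top _ _)
  rw [Ne, Measure.measure_univ_eq_zero]
  exact Measure.toSphere_ne_zero _

open scoped Pointwise in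
/-- Great subspheres are null sets. -/
lemma sphereUniform_inner_eq_zero {d : ℕ} {z : EuclideanSpace ℝ (Fin d)} (hz : z ≠ 0) :
    sphereUniform d {s | inner ℝ (s : EuclideanSpace ℝ (Fin d)) z = 0} = 0 := by
  have hm : MeasurableSet {s : UnitSphere d | inner ℝ (s : EuclideanSpace ℝ (Fin d)) z = 0} :=
    (isClosed_eq (by fun_prop) continuous_const).measurableSet
  rw [sphereUniform, Measure.smul_apply, Measure.toSphere_apply' _ hm]
  -- `toSphere` measures the cone over the set, which here lies in the proper subspace orthogonal to
  -- z.
  have hV : (ℝ ∙ z)ᗮ ≠ ⊤ := by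
    rw [Ne, Submodule.orthogonal_eq_top_iff, Submodule.span_singleton_eq_bot]
    exact hz
  have h0 : volume (Ioo (0 : ℝ) 1 • Subtype.val ''
      {s : UnitSphere d | inner ℝ (s : EuclideanSpace ℝ (Fin d)) z = 0}) = 0 := by
    refine measure_mono_null ?_ (Measure.addHaar_submodule volume _ hV)
    rintro _ ⟨c, _, _, ⟨s, hs, rfl⟩, rfl⟩
    refine Submodule.smul_mem _ _ ?_
    rw [Submodule.mem_orthogonal_singleton_iff_inner_left]
    exact hs
  rw [h0]
  simp

instance isProbabilityMeasure_projMeasure {d : ℕ} (μ : Measure (EuclideanSpace ℝ (Fin d)))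
    [IsProbabilityMeasure μ] (s : UnitSphere d) : IsProbabilityMeasure (projMeasure μ s) :=
  Measure.isProbabilityMeasure_map (by fun_prop)

/-- The diagonal is null for ν ⊗ ν, and for x ≠ y almost no s identifies the projections. By Fubini,
for almost every s the pairs with equal projection are null. They contain the square of every fibre,
so all levels c are handled at once. -/
lemma ae_projMeasure_singleton_eq_zero {d : ℕ} (hd : 1 ≤ d)
    {ν : Measure (EuclideanSpace ℝ (Fin d))} [IsProbabilityMeasure ν] (hν : ∀ x, ν {x} = 0) :
    ∀ᵐ s ∂(sphereUniform d), ∀ c, projMeasure ν s {c} = 0 := by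
  have := isProbabilityMeasure_sphereUniform hd
  set S : Set (UnitSphere d × (EuclideanSpace ℝ (Fin d) × EuclideanSpace ℝ (Fin d))) :=
    {p | inner ℝ (p.1 : EuclideanSpace ℝ (Fin d)) p.2.1
      = inner ℝ (p.1 : EuclideanSpace ℝ (Fin d)) p.2.2} with hS
  have hSm : MeasurableSet S := (isClosed_eq (by fun_prop) (by fun_prop)).measurableSet
  have hdiag : ∀ᵐ z ∂(ν.prod ν), z.1 ≠ z.2 := by
    have hm : MeasurableSet
        {z : EuclideanSpace ℝ (Fin d) × EuclideanSpace ℝ (Fin d) | z.1 = z.2} :=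
      (isClosed_eq continuous_fst continuous_snd).measurableSet
    have : (ν.prod ν) {z | z.1 = z.2} = 0 := by
      rw [Measure.measure_prod_null hm]
      refine ae_of_all _ fun x => ?_
      have : Prod.mk x ⁻¹'
          {z : EuclideanSpace ℝ (Fin d) × EuclideanSpace ℝ (Fin d) | z.1 = z.2} = {x} := by
        ext y; simp [eq_comm]
      simp only [this, hν, Pi.zero_apply]
    rw [ae_iff]
    simpa using this
  have h0 : ((sphereUniform d).prod (ν.prod ν)) S = 0 := by
    rw [Measure.prod_apply_symm hSm, lintegral_eq_zero_iff (measurable_measure_prodMk_right hSm)]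
    filter_upwards [hdiag] with z hz
    have : (fun s : UnitSphere d => (s, z)) ⁻¹' S
        = {s : UnitSphere d | inner ℝ (s : EuclideanSpace ℝ (Fin d)) (z.1 - z.2) = 0} := by
      ext s
      simp [hS, inner_sub_right, sub_eq_zero]
    rw [this, sphereUniform_inner_eq_zero (sub_ne_zero.2 hz)]
    rfl
  rw [Measure.measure_prod_null hSm] at h0
  filter_upwards [h0] with s hs c
  have hsub : ((fun x : EuclideanSpace ℝ (Fin d) => inner ℝ (s : EuclideanSpace ℝ (Fin d)) x)
      ⁻¹' {c}) ×ˢ ((fun x : EuclideanSpace ℝ (Fin d) =>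
        inner ℝ (s : EuclideanSpace ℝ (Fin d)) x) ⁻¹' {c}) ⊆ Prod.mk s ⁻¹' S := by
    rintro ⟨x, y⟩ ⟨hx, hy⟩
    exact (show inner ℝ (s : EuclideanSpace ℝ (Fin d)) x = c from hx).trans hy.symm
  have h := measure_mono_null hsub hs
  rw [Measure.prod_prod, mul_self_eq_zero] at h
  rw [projMeasure, Measure.map_apply (by fun_prop) (measurableSet_singleton c), h]

/-- The projected cdf at a projected point is jointly measurable in s and the point; integrating out
the point keeps measurability in s. -/
lemma measurable_rankPmf_projMeasure {d : ℕ} (μ ν : Measure (EuclideanSpace ℝ (Fin d)))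
    [IsProbabilityMeasure μ] [IsProbabilityMeasure ν] (K n : ℕ) :
    Measurable fun s : UnitSphere d => rankPmf (projMeasure μ s) (projMeasure ν s) K n := by
  have hF : ∀ (s : UnitSphere d) (t : ℝ), cdf (projMeasure ν s) t
      = (ν {y | inner ℝ (s : EuclideanSpace ℝ (Fin d)) y ≤ t}).toReal := by
    intro s t
    rw [cdf_eq_real, measureReal_def, projMeasure,
      Measure.map_apply (by fun_prop) measurableSet_Iic]
    rfl
  have hS : MeasurableSet {p : (UnitSphere d × EuclideanSpace ℝ (Fin d)) ×
      EuclideanSpace ℝ (Fin d) | inner ℝ (p.1.1 : EuclideanSpace ℝ (Fin d)) p.2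
        ≤ inner ℝ (p.1.1 : EuclideanSpace ℝ (Fin d)) p.1.2} :=
    (isClosed_le (by fun_prop) (by fun_prop)).measurableSet
  have hG : Measurable fun p : UnitSphere d × EuclideanSpace ℝ (Fin d) =>
      cdf (projMeasure ν p.1) (inner ℝ (p.1 : EuclideanSpace ℝ (Fin d)) p.2) := by
    simp_rw [hF]
    exact (measurable_measure_prodMk_left hS).ennreal_toReal
  have e : ∀ s : UnitSphere d, (rankPmf (projMeasure μ s) (projMeasure ν s) K n : ℝ≥0∞)
      = ∫⁻ x, ENNReal.ofReal (bernsteinWeight K n (cdf (projMeasure ν s)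
        (inner ℝ (s : EuclideanSpace ℝ (Fin d)) x))) ∂μ := by
    intro s
    rw [rankPmf_eq_lintegral]
    conv_lhs => rw [projMeasure]
    rw [lintegral_map _ (by fun_prop)]
    exact ((continuous_bernsteinWeight K n).measurable.comp
      (measurable_cdf _)).ennreal_ofReal
  have hm : Measurable fun s : UnitSphere d =>
      (rankPmf (projMeasure μ s) (projMeasure ν s) K n : ℝ≥0∞) := by
    simp_rw [e]
    exact (((continuous_bernsteinWeight K n).measurable.comp hG).ennreal_ofReal).lintegral_prod_right'
  simpa using hm.ennreal_toNNReal

lemma measurable_affineSupRankDivergence_projMeasure {d : ℕ} (α β : ℕ → ℝ) (K : ℕ)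
    (μ ν : Measure (EuclideanSpace ℝ (Fin d)))
    [IsProbabilityMeasure μ] [IsProbabilityMeasure ν] :
    Measurable fun s : UnitSphere d =>
      affineSupRankDivergence α β K (projMeasure ν s) (projMeasure μ s) := by
  unfold affineSupRankDivergence
  refine Measurable.const_mul (Finset.measurable_sum _ fun n _ => ?_) _
  exact (measurable_affineSup α β).comp
    ((measurable_rankPmf_projMeasure μ ν K n).const_mul _)

/-! ### Sliced divergences and convexity. -/

lemma HasAffineDecomposition.slicedRankDivergence_eq {d : ℕ} (hd : 1 ≤ d) {f : ℝ≥0 → EReal}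
    {a b : ℝ} {α β : ℕ → ℝ} (hf : HasAffineDecomposition f a b α β) (K : ℕ)
    (ν μ : Measure (EuclideanSpace ℝ (Fin d)))
    [IsProbabilityMeasure ν] [IsProbabilityMeasure μ] :
    affineSup α β 1 ≤ ∫⁻ s, affineSupRankDivergence α β K (projMeasure ν s) (projMeasure μ s)
      ∂(sphereUniform d) ∧
    slicedRankDivergence f K ν μ = (((∫⁻ s, affineSupRankDivergence α β K (projMeasure ν s)
      (projMeasure μ s) ∂(sphereUniform d)) - affineSup α β 1 : ℝ≥0∞) : EReal) := by
  have := isProbabilityMeasure_sphereUniform hd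
  have hle : ∀ s : UnitSphere d, affineSup α β 1
      ≤ affineSupRankDivergence α β K (projMeasure ν s) (projMeasure μ s) := fun s =>
    affineSup_one_le_affineSupRankDivergence α β K (sum_rankPmf _ _ K)
  have hc : ∫⁻ _, affineSup α β 1 ∂(sphereUniform d) = affineSup α β 1 := by simp
  refine ⟨hc ▸ lintegral_mono hle, ?_⟩
  rw [slicedRankDivergence]
  simp_rw [fun s : UnitSphere d => hf.rankDivergence_eq K
    (sum_rankPmf (projMeasure μ s) (projMeasure ν s) K)]
  rw [eintegral_coe, lintegral_sub measurable_const
    (by rw [hc]; exact hf.affineSup_one_ne_top) (ae_of_all _ hle), hc]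

lemma HasAffineDecomposition.slicedFDivergence_eq {d : ℕ} (hd : 1 ≤ d) {f : ℝ≥0 → EReal}
    {a b : ℝ} {α β : ℕ → ℝ} (hf : HasAffineDecomposition f a b α β)
    {ν μ : Measure (EuclideanSpace ℝ (Fin d))}
    [IsProbabilityMeasure ν] [IsProbabilityMeasure μ] (h : μ ≪ ν) :
    slicedFDivergence f ν μ = (((∫⁻ s, affineSupDivergence α β (projMeasure ν s)
      (projMeasure μ s) ∂(sphereUniform d)) - affineSup α β 1 : ℝ≥0∞) : EReal) := by
  have := isProbabilityMeasure_sphereUniform hd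
  have hs : ∀ s : UnitSphere d, projMeasure μ s ≪ projMeasure ν s := fun s =>
    h.map (by fun_prop)
  have hc : ∫⁻ _, affineSup α β 1 ∂(sphereUniform d) = affineSup α β 1 := by simp
  rw [slicedFDivergence]
  simp_rw [fun s : UnitSphere d => hf.fDivergence_eq (hs s)]
  -- Only the subtracted constant has to be measurable, not the divergence as a function of s.
  rw [eintegral_coe, lintegral_sub measurable_const
    (by rw [hc]; exact hf.affineSup_one_ne_top)
    (ae_of_all _ fun s => affineSup_one_le_affineSupDivergence α β (hs s)), hc]

lemma isProbabilityMeasure_convex_combination {Ω : Type*} [MeasurableSpace Ω]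
    (μ₁ μ₂ : Measure Ω) [IsProbabilityMeasure μ₁] [IsProbabilityMeasure μ₂] {a b : ℝ≥0}
    (hab : a + b = 1) : IsProbabilityMeasure (a • μ₁ + b • μ₂) := by
  refine ⟨?_⟩
  simp only [Measure.coe_add, Pi.add_apply, Measure.smul_apply, measure_univ]
  rw [ENNReal.smul_def, ENNReal.smul_def, smul_eq_mul, smul_eq_mul, mul_one, mul_one]
  exact_mod_cast hab

lemma projMeasure_convex_combination {d : ℕ} (μ₁ μ₂ : Measure (EuclideanSpace ℝ (Fin d)))
    (a b : ℝ≥0) (s : UnitSphere d) :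
    projMeasure (a • μ₁ + b • μ₂) s = a • projMeasure μ₁ s + b • projMeasure μ₂ s := by
  have hm : Measurable fun x : EuclideanSpace ℝ (Fin d) =>
    inner ℝ (s : EuclideanSpace ℝ (Fin d)) x := by fun_prop
  simp only [projMeasure, Measure.map_add _ _ hm, Measure.map_smul]

lemma rankPmf_convex_combination (μ₁ μ₂ ν : Measure ℝ) [IsProbabilityMeasure μ₁]
    [IsProbabilityMeasure μ₂] [IsProbabilityMeasure ν] {a b : ℝ≥0} (hab : a + b = 1) (K n : ℕ) :
    rankPmf (a • μ₁ + b • μ₂) ν K n = a * rankPmf μ₁ ν K n + b * rankPmf μ₂ ν K n := by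
  have := isProbabilityMeasure_convex_combination μ₁ μ₂ hab
  rw [← ENNReal.coe_inj]
  push_cast
  simp_rw [rankPmf_eq_lintegral]
  rw [lintegral_add_measure, lintegral_smul_measure, lintegral_smul_measure]
  rfl

lemma affineSupRankDivergence_convex (α β : ℕ → ℝ) (K : ℕ) (μ₁ μ₂ ν : Measure ℝ)
    [IsProbabilityMeasure μ₁] [IsProbabilityMeasure μ₂] [IsProbabilityMeasure ν] {a b : ℝ≥0}
    (hab : a + b = 1) :
    affineSupRankDivergence α β K ν (a • μ₁ + b • μ₂)
      ≤ a * affineSupRankDivergence α β K ν μ₁ + b * affineSupRankDivergence α β K ν μ₂ := by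
  simp only [affineSupRankDivergence]
  rw [mul_left_comm (a : ℝ≥0∞), mul_left_comm (b : ℝ≥0∞), ← mul_add,
    Finset.mul_sum _ _ (a : ℝ≥0∞), Finset.mul_sum _ _ (b : ℝ≥0∞), ← Finset.sum_add_distrib]
  gcongr with n hn
  rw [rankPmf_convex_combination μ₁ μ₂ ν hab, mul_add, mul_left_comm _ a, mul_left_comm _ b]
  exact affineSup_convex α β _ _ a b hab

lemma IsEntropyFunction.exists_hasAffineDecomposition {f : ℝ≥0 → EReal}
    (hf : IsEntropyFunction f) : ∃ a b α β, HasAffineDecomposition f a b α β := by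
  obtain ⟨a, b, α, β, h⟩ := hf.exists_eq_affineSup
  exact ⟨a, b, α, β, hf.map_one, h⟩

lemma HasAffineDecomposition.slicedRankDivergence_convex {d : ℕ} (hd : 1 ≤ d)
    {f : ℝ≥0 → EReal} {p q : ℝ} {α β : ℕ → ℝ} (hf : HasAffineDecomposition f p q α β)
    (ν : Measure (EuclideanSpace ℝ (Fin d))) [IsProbabilityMeasure ν] (K : ℕ)
    (μ₁ μ₂ : Measure (EuclideanSpace ℝ (Fin d)))
    [IsProbabilityMeasure μ₁] [IsProbabilityMeasure μ₂] {a b : ℝ≥0} (hab : a + b = 1) :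
    slicedRankDivergence f K ν (a • μ₁ + b • μ₂) ≤
      ((a : ℝ) : EReal) * slicedRankDivergence f K ν μ₁ +
        ((b : ℝ) : EReal) * slicedRankDivergence f K ν μ₂ := by
  have := isProbabilityMeasure_convex_combination μ₁ μ₂ hab
  obtain ⟨h₁, e₁⟩ := hf.slicedRankDivergence_eq hd K ν μ₁
  obtain ⟨h₂, e₂⟩ := hf.slicedRankDivergence_eq hd K ν μ₂
  obtain ⟨-, e⟩ := hf.slicedRankDivergence_eq hd K ν (a • μ₁ + b • μ₂)
  rw [e, e₁, e₂]
  set X₁ := ∫⁻ s, affineSupRankDivergence α β K (projMeasure ν s) (projMeasure μ₁ s)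
      ∂(sphereUniform d) with hX₁
  set X₂ := ∫⁻ s, affineSupRankDivergence α β K (projMeasure ν s) (projMeasure μ₂ s)
      ∂(sphereUniform d) with hX₂
  set c := affineSup α β 1
  change _ ≤ ((a : ℝ≥0∞) : EReal) * _ + ((b : ℝ≥0∞) : EReal) * _
  rw [← EReal.coe_ennreal_mul, ← EReal.coe_ennreal_mul, ← EReal.coe_ennreal_add,
    EReal.coe_ennreal_le_coe_ennreal_iff, tsub_le_iff_right]
  have hm₁ := measurable_affineSupRankDivergence_projMeasure α β K μ₁ ν
  have hm₂ := measurable_affineSupRankDivergence_projMeasure α β K μ₂ ν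
  have hX : ∫⁻ s, affineSupRankDivergence α β K (projMeasure ν s)
      (projMeasure (a • μ₁ + b • μ₂) s) ∂(sphereUniform d) ≤ a * X₁ + b * X₂ := by
    rw [hX₁, hX₂, ← lintegral_const_mul _ hm₁, ← lintegral_const_mul _ hm₂,
      ← lintegral_add_left (hm₁.const_mul _)]
    refine lintegral_mono fun s => ?_
    simp only [projMeasure_convex_combination]
    exact affineSupRankDivergence_convex α β K _ _ _ hab
  refine hX.trans (le_of_eq ?_)
  -- As a + b = 1, the subtracted constant splits between the two terms.
  have hc : c = a * c + b * c := by
    rw [← add_mul, show (a : ℝ≥0∞) + b = 1 by exact_mod_cast hab, one_mul]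
  calc (a : ℝ≥0∞) * X₁ + b * X₂ = a * (X₁ - c + c) + b * (X₂ - c + c) := by
        rw [tsub_add_cancel_of_le h₁, tsub_add_cancel_of_le h₂]
    _ = a * (X₁ - c) + b * (X₂ - c) + (a * c + b * c) := by ring
    _ = _ := by rw [← hc]

end

/-! ### The main theorem. -/

theorem theorem3p2 {d : ℕ} (hd : 1 ≤ d) (f : ℝ≥0 → EReal) (hf : IsEntropyFunction f) :
    -- convexity of the sliced rank-statistic divergence on the probability measures on `ℝ^d`
    (∀ (ν : Measure (EuclideanSpace ℝ (Fin d))) [IsProbabilityMeasure ν] (K : ℕ)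
      (μ₁ μ₂ : Measure (EuclideanSpace ℝ (Fin d)))
      [IsProbabilityMeasure μ₁] [IsProbabilityMeasure μ₂] (a b : ℝ≥0), a + b = 1 →
        slicedRankDivergence f K ν (a • μ₁ + b • μ₂) ≤
          ((a : ℝ) : EReal) * slicedRankDivergence f K ν μ₁ +
            ((b : ℝ) : EReal) * slicedRankDivergence f K ν μ₂) ∧
    -- the bounds, and the limit as `K → ∞`; `∀ x, ν {x} = 0` says that `ν` has no atoms
    (∀ (μ ν : Measure (EuclideanSpace ℝ (Fin d)))
      [IsProbabilityMeasure μ] [IsProbabilityMeasure ν], μ ≪ ν →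
        ((∀ x, ν {x} = 0) → ∀ K : ℕ, slicedRankDivergence f K ν μ ≤ slicedFDivergence f ν μ) ∧
        slicedFDivergence f ν μ ≤ fDivergence f ν μ ∧
        ((∀ x, ν {x} = 0) →
          (∀ᵐ s ∂(sphereUniform d),
            HasContinuousQuantileRatio (projMeasure μ s) (projMeasure ν s)) →
          Tendsto (fun K : ℕ => slicedRankDivergence f K ν μ) atTop
            (𝓝 (slicedFDivergence f ν μ)))) := by
  obtain ⟨p, q, α, β, hf'⟩ := hf.exists_hasAffineDecomposition
  have := isProbabilityMeasure_sphereUniform hd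
  refine ⟨fun ν _ K μ₁ μ₂ _ _ a b hab => hf'.slicedRankDivergence_convex hd ν K μ₁ μ₂ hab,
    fun μ ν _ _ h => ?_⟩
  have hs : ∀ s : UnitSphere d, projMeasure μ s ≪ projMeasure ν s := fun s =>
    h.map (by fun_prop)
  have hle : (∀ x, ν {x} = 0) → ∀ K : ℕ,
      ∫⁻ s, affineSupRankDivergence α β K (projMeasure ν s) (projMeasure μ s) ∂(sphereUniform d)
      ≤ ∫⁻ s, affineSupDivergence α β (projMeasure ν s) (projMeasure μ s) ∂(sphereUniform d) := by
    intro hν K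
    refine lintegral_mono_ae ?_
    filter_upwards [ae_projMeasure_singleton_eq_zero hd hν] with s hνs
    exact affineSupRankDivergence_le α β K (hs s) hνs
  refine ⟨fun hν K => ?_, ?_, fun hν hc => ?_⟩
  · rw [(hf'.slicedRankDivergence_eq hd K ν μ).2, hf'.slicedFDivergence_eq hd h,
      EReal.coe_ennreal_le_coe_ennreal_iff]
    exact tsub_le_tsub_right (hle hν K) _
  · rw [hf'.slicedFDivergence_eq hd h, hf'.fDivergence_eq h, EReal.coe_ennreal_le_coe_ennreal_iff]
    refine tsub_le_tsub_right ?_ _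
    calc _ ≤ ∫⁻ _, affineSupDivergence α β ν μ ∂(sphereUniform d) :=
          lintegral_mono fun s => lintegral_affineSup_rnDeriv_map_le α β h (by fun_prop)
      _ = _ := by simp
  · simp_rw [fun K => (hf'.slicedRankDivergence_eq hd K ν μ).2]
    rw [hf'.slicedFDivergence_eq hd h]
    -- Subtraction passes to the limit, even an infinite one, because the subtracted constant is
    -- finite.
    refine (continuous_coe_ennreal_ereal.tendsto _).comp
      (ENNReal.Tendsto.sub ?_ tendsto_const_nhds (Or.inr hf'.affineSup_one_ne_top))
    refine tendsto_of_le_liminf_of_limsup_le ?_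
      (limsup_le_of_le (by isBoundedDefault) (Eventually.of_forall (hle hν)))
    -- Fatou on the sphere reduces the lower bound to almost every slice.
    refine le_trans (lintegral_mono_ae ?_) (lintegral_liminf_le fun K =>
      measurable_affineSupRankDivergence_projMeasure α β K μ ν)
    filter_upwards [ae_projMeasure_singleton_eq_zero hd hν, hc] with s hνs hcs
    exact affineSupDivergence_le_liminf α β (hs s) hνs hcs
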